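/- Let $\delta>0$, let $(S,d)$ be a $\delta$-hyperbolic space, i.e. a geodesic metric space in which every side of every geodesic triangle is contained in the closed $\delta$-neighborhood of the union of the other two sides, and let $\Gamma$ be a group acting on $S$ by isometries. Assume that the action is acylindrical: for every $r>0$ there exist $R,N>0$ such that for all $x,x'\in S$ with $d(x,x')\ge R$, \[ \#\{g\in\Gamma \mid d(x,gx)\le r \text{ and } d(x',gx')\le r\}\le N . \] An element $g\in\Gamma$ is called loxodromic if its translation length $\tau(g)=\lim_{n\to\infty}\frac1n d(x,g^nx)$ (which does not depend on $x\in S$) is positive. It is called achiral if $g^m$ is conjugate to $g^{-m}$ in $\Gamma$ for some integer $m>0$, and chiral otherwise. For $g\in[\Gamma,\Gamma]$ let $\mathrm{cl}(g)$ be the least number of commutators in $\Gamma$ whose product is $g$, and $\mathrm{scl}(g)=\lim_{n\to\infty}\mathrm{cl}(g^n)/n$; for general $g\in\Gamma$ put $\mathrm{scl}(g)=\mathrm{scl}(g^m)/m$ if $g^m\in[\Gamma,\Gamma]$ for some integer $m>0$ (the value does not depend on $m$), and $\mathrm{scl}(g)=\infty$ if there is no such $m$. Then: \begin{enumerate} \item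 A loxodromic element $g\in\Gamma$ is achiral if and only if $\mathrm{scl}(g)=0$. \item There exists a constant $\Theta>0$ such that $\mathrm{scl}(g)\ge\Theta$ for every chiral loxodromic element $g\in\Gamma$. \end{enumerate} -/

import Mathlib

namespace SclGap

open Filter Topology
open scoped ENNReal

/-! ### Hyperbolic geodesic spaces -/

section Hyperbolic

variable {S : Type*} [MetricSpace S]

/-- `A` is (the image of) a geodesic from `x` to `y`. -/
def IsGeodesicSegment (A : Set S) (x y : S) : Prop :=
  ∃ c : ℝ → S, c 0 = x ∧ c (dist x y) = y ∧
    (∀ s ∈ Set.Icc 0 (dist x y), ∀ t ∈ Set.Icc 0 (dist x y), dist (c s) (c t) = |s - t|) ∧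
    A = c '' Set.Icc 0 (dist x y)

/-- `A` is contained in the closed `δ`-neighbourhood of `B`. For a nonempty compact `B`, such as
a union of geodesic segments, this is the condition `d(p, B) ≤ δ` for all `p ∈ A`. -/
def InNeighborhood (δ : ℝ) (A B : Set S) : Prop :=
  ∀ p ∈ A, ∃ q ∈ B, dist p q ≤ δ

variable (S) in
/-- `S` is a geodesic space all of whose geodesic triangles are `δ`-slim. -/
structure IsHyperbolicSpace (δ : ℝ) : Prop where
  exists_geodesic : ∀ x y : S, ∃ A : Set S, IsGeodesicSegment A x y
  slim : ∀ (x y z : S) (A B C : Set S), IsGeodesicSegment A x y → IsGeodesicSegment B y z →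
    IsGeodesicSegment C z x →
      InNeighborhood δ A (B ∪ C) ∧ InNeighborhood δ B (C ∪ A) ∧ InNeighborhood δ C (A ∪ B)

end Hyperbolic

/-! ### Acylindrical actions and loxodromic elements -/

section Action

variable {Γ S : Type*} [Group Γ] [MetricSpace S] [MulAction Γ S]

variable (Γ S) in
/-- The action of `Γ` on `S` is acylindrical. -/
def IsAcylindrical : Prop :=
  ∀ r : ℝ, 0 < r → ∃ (R : ℝ) (N : ℕ), 0 < R ∧ 0 < N ∧ ∀ x x' : S, R ≤ dist x x' →
    {g : Γ | dist x (g • x) ≤ r ∧ dist x' (g • x') ≤ r}.encard ≤ N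

/-- The translation length `lim_{n → ∞} d(x, gⁿ x) / n`, computed at the point `x`. For an
isometric action the limit exists and is independent of `x`, see `tendsto_translationLength`
and `translationLength_eq`. -/
noncomputable def translationLength (g : Γ) (x : S) : ℝ :=
  limUnder atTop (fun n : ℕ => dist x (g ^ n • x) / n)

theorem tendsto_translationLength [IsIsometricSMul Γ S] (g : Γ) (x : S) :
    Tendsto (fun n : ℕ => dist x (g ^ n • x) / n) atTop (𝓝 (translationLength g x)) := by
  have h : Subadditive (fun n : ℕ => dist x (g ^ n • x)) := by
    intro m n
    calc dist x (g ^ (m + n) • x)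
        ≤ dist x (g ^ m • x) + dist (g ^ m • x) (g ^ (m + n) • x) := dist_triangle _ _ _
      _ = dist x (g ^ m • x) + dist x (g ^ n • x) := by rw [pow_add, mul_smul, dist_smul]
  refine tendsto_nhds_limUnder ⟨_, h.tendsto_lim ⟨0, ?_⟩⟩
  rintro _ ⟨n, rfl⟩
  positivity

theorem translationLength_eq [IsIsometricSMul Γ S] (g : Γ) (x y : S) :
    translationLength g x = translationLength g y := by
  have key : Tendsto (fun n : ℕ => dist x (g ^ n • x) / n - dist y (g ^ n • y) / n) atTop
      (𝓝 0) := by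
    refine squeeze_zero_norm (a := fun n : ℕ => (2 * dist x y) / n) (fun n => ?_)
      (tendsto_const_div_atTop_nhds_zero_nat _)
    rw [← sub_div, norm_div, Real.norm_natCast]
    gcongr
    rw [Real.norm_eq_abs, abs_le]
    have h1 := dist_triangle4 x y (g ^ n • y) (g ^ n • x)
    have h2 := dist_triangle4 y x (g ^ n • x) (g ^ n • y)
    rw [dist_smul] at h1 h2
    rw [dist_comm y x] at h1 h2
    constructor <;> linarith
  have := tendsto_nhds_unique key
    ((tendsto_translationLength g x).sub (tendsto_translationLength g y))
  linarith

variable (S) in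
/-- `g` acts on `S` with positive translation length. -/
def IsLoxodromic (g : Γ) : Prop :=
  ∃ x : S, 0 < translationLength g x

end Action

/-! ### Achiral elements, word norms and stable commutator length -/

section Norms

variable {Γ : Type*} [Group Γ]

/-- Some positive power `a ^ m` is conjugate to `a ^ (-m)`. -/
def IsAchiral (a : Γ) : Prop :=
  ∃ m : ℕ, 0 < m ∧ IsConj (a ^ m) (a ^ (-(m : ℤ)))

/-- An element is chiral if it is not achiral. -/
def IsChiral (a : Γ) : Prop := ¬ IsAchiral a

/-- The word norm of a symmetric set `A`: the least number of elements of `A` whose product is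
`g`. Meaningful for `g` in the subgroup generated by `A`. -/
noncomputable def wordNorm (A : Set Γ) (g : Γ) : ℕ :=
  sInf {n : ℕ | ∃ l : List Γ, l.length = n ∧ (∀ a ∈ l, a ∈ A) ∧ l.prod = g}

/-- The limit of `ν_A(gⁿ) / n`, for `g` in the subgroup generated by the symmetric set `A`. It
exists by `tendsto_stableWordNorm`. -/
noncomputable def stableWordNorm (A : Set Γ) (g : Γ) : ℝ :=
  limUnder atTop (fun n : ℕ => (wordNorm A (g ^ n) : ℝ) / n)

open Classical in
/-- The stable norm of a symmetric set `A`, extended to all of `Γ`: if a positive power `g ^ m`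
lies in the subgroup generated by `A`, it is the stable norm of `g ^ m` divided by `m`
(independently of `m`, see `extStableWordNorm_eq`); otherwise it is `∞`. -/
noncomputable def extStableWordNorm (A : Set Γ) (g : Γ) : ℝ≥0∞ :=
  if h : ∃ m : ℕ, 0 < m ∧ g ^ m ∈ Subgroup.closure A then
    ENNReal.ofReal (stableWordNorm A (g ^ Nat.find h) / (Nat.find h : ℝ))
  else ⊤

/-- Stable commutator length: the extended stable norm of the set of all commutators. -/
noncomputable def scl (g : Γ) : ℝ≥0∞ :=
  extStableWordNorm (commutatorSet Γ) g

theorem exists_word {A : Set Γ} (hA : ∀ a ∈ A, a⁻¹ ∈ A) {g : Γ} (hg : g ∈ Subgroup.closure A) :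
    ∃ l : List Γ, l.length = wordNorm A g ∧ (∀ a ∈ l, a ∈ A) ∧ l.prod = g := by
  have hne : {n : ℕ | ∃ l : List Γ, l.length = n ∧ (∀ a ∈ l, a ∈ A) ∧ l.prod = g}.Nonempty := by
    rw [← Subgroup.mem_toSubmonoid, Subgroup.closure_toSubmonoid] at hg
    obtain ⟨l, hl, hp⟩ := Submonoid.exists_list_of_mem_closure hg
    refine ⟨l.length, l, rfl, fun a ha => ?_, hp⟩
    rcases hl a ha with h | h
    · exact h
    · simpa using hA _ h
  exact Nat.sInf_mem hne

theorem wordNorm_mul_le {A : Set Γ} (hA : ∀ a ∈ A, a⁻¹ ∈ A) {g h : Γ}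
    (hg : g ∈ Subgroup.closure A) (hh : h ∈ Subgroup.closure A) :
    wordNorm A (g * h) ≤ wordNorm A g + wordNorm A h := by
  obtain ⟨l, hl, hlA, hlp⟩ := exists_word hA hg
  obtain ⟨k, hk, hkA, hkp⟩ := exists_word hA hh
  refine Nat.sInf_le ⟨l ++ k, by simp [hl, hk], ?_, by simp [hlp, hkp]⟩
  intro a ha
  rcases List.mem_append.1 ha with h | h
  · exact hlA a h
  · exact hkA a h

theorem tendsto_stableWordNorm {A : Set Γ} (hA : ∀ a ∈ A, a⁻¹ ∈ A) {g : Γ}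
    (hg : g ∈ Subgroup.closure A) :
    Tendsto (fun n : ℕ => (wordNorm A (g ^ n) : ℝ) / n) atTop (𝓝 (stableWordNorm A g)) := by
  have h : Subadditive (fun n : ℕ => (wordNorm A (g ^ n) : ℝ)) := by
    intro m n
    simp only [pow_add]
    exact_mod_cast wordNorm_mul_le hA (pow_mem hg m) (pow_mem hg n)
  refine tendsto_nhds_limUnder ⟨_, h.tendsto_lim ⟨0, ?_⟩⟩
  rintro _ ⟨n, rfl⟩
  positivity

theorem stableWordNorm_pow {A : Set Γ} (hA : ∀ a ∈ A, a⁻¹ ∈ A) {g : Γ}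
    (hg : g ∈ Subgroup.closure A) {m : ℕ} (hm : 0 < m) :
    stableWordNorm A (g ^ m) = m * stableWordNorm A g := by
  have h1 := tendsto_stableWordNorm hA (pow_mem hg m)
  have h2 := ((tendsto_stableWordNorm hA hg).comp (tendsto_id.const_mul_atTop' hm)).const_mul
    (m : ℝ)
  refine tendsto_nhds_unique h1 (h2.congr fun n => ?_)
  have : (m : ℝ) ≠ 0 := by positivity
  rcases Nat.eq_zero_or_pos n with rfl | hn
  · simp
  · have : (n : ℝ) ≠ 0 := by positivity
    simp only [Function.comp, id, pow_mul, Nat.cast_mul]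
    field_simp

theorem extStableWordNorm_eq {A : Set Γ} (hA : ∀ a ∈ A, a⁻¹ ∈ A) {g : Γ} {m : ℕ} (hm : 0 < m)
    (hg : g ^ m ∈ Subgroup.closure A) :
    extStableWordNorm A g = ENNReal.ofReal (stableWordNorm A (g ^ m) / m) := by
  have aux : ∀ k : ℕ, 0 < k ∧ g ^ k ∈ Subgroup.closure A →
      stableWordNorm A (g ^ k) / (k : ℝ) = stableWordNorm A (g ^ m) / m := by
    rintro k ⟨hk, hgk⟩
    have e1 := stableWordNorm_pow hA hgk hm
    have e2 := stableWordNorm_pow hA hg hk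
    rw [← pow_mul] at e1 e2
    rw [mul_comm, e1] at e2
    have : (m : ℝ) ≠ 0 := by positivity
    have : (k : ℝ) ≠ 0 := by positivity
    field_simp
    linarith
  have h : ∃ m : ℕ, 0 < m ∧ g ^ m ∈ Subgroup.closure A := ⟨m, hm, hg⟩
  classical
  rw [extStableWordNorm, dif_pos h]
  exact congrArg ENNReal.ofReal (aux _ (Nat.find_spec h))

end Norms

end SclGap

/-!
Fix a chiral loxodromic `g`. By acylindricity the translation lengths of loxodromic elements are
bounded below, so a long piece from `x₀` to `g ^ N • x₀` of a quasi-axis of `g` can be chosen with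
`N` independent of `g`. Following Epstein and Fujiwara, one is granted a fixed discount `Δ` for
each travel along a translate of this piece, in the given direction. Nearly optimal routes for the
discounted distance `ρ` are quasi-geodesics, so by their stability `ρ` is additive along geodesics
up to an error independent of `g`; since `x₀`, `a • x₀` and `a • b • x₀` span a tripod up to a
bounded error, `a ↦ ρ x₀ (a • x₀) - ρ (a • x₀) x₀` is a quasimorphism of uniform defect.

The way from `x₀` to `g ^ (N * n) • x₀` earns `n` discounts. If the way back earned one, then a
translate by some `γ` of the piece would run backwards along the axis, and the elements
`γ * g ^ i * γ⁻¹ * g ^ i` would almost fix two far apart points; by acylindricity two of them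
coincide, which makes `g` achiral. Hence the quasimorphism grows linearly on the powers of `g ^ N`,
at a uniform rate, and bounds `scl g` from below.

Conversely, if `h * a * h⁻¹ = a⁻¹`, then every power of `a ^ 2` is a commutator.
-/

namespace SclGap

open Filter Topology
open scoped ENNReal NNReal

/-! ### The four-point condition -/

section FourPoint

variable {S : Type*} [PseudoMetricSpace S] {κ : ℝ}

variable (S) in
/-- Gromov's four-point form of hyperbolicity. -/
def FourPointCondition (κ : ℝ) : Prop :=
  ∀ x y z t : S, dist x y + dist z t ≤ max (dist x z + dist y t) (dist x t + dist y z) + κ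

variable (S) in
/-- Any two points are joined by a geodesic, parametrized by arc length. -/
def IsGeodesicSpace : Prop :=
  ∀ x y : S, ∃ c : ℝ → S, c 0 = x ∧ c (dist x y) = y ∧
    ∀ s ∈ Set.Icc 0 (dist x y), ∀ t ∈ Set.Icc 0 (dist x y), dist (c s) (c t) = |s - t|

/-- Twice the Gromov product of `x` and `y` based at `p`: the length of the detour through `p` on
the way from `x` to `y`. -/
def excess (x y p : S) : ℝ := dist x p + dist p y - dist x y

/-- Up to the error `e`, the point `p` lies at distance `r` from `x` on a geodesic from `x` to
`y`. -/
def IsNearPosition (x y : S) (r e : ℝ) (p : S) : Prop :=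
  dist x p ≤ r + e ∧ dist p y ≤ dist x y - r + e

theorem excess_comm (x y p : S) : excess x y p = excess y x p := by
  rw [excess, excess, dist_comm x y, dist_comm x p, dist_comm p y, add_comm (dist p x)]

theorem excess_le_two_mul_dist_add (x y p q : S) :
    excess x y p ≤ excess x y q + 2 * dist p q := by
  have hx := dist_triangle x q p
  have hy := dist_triangle p q y
  rw [dist_comm q p] at hx
  unfold excess
  linarith

theorem excess_le_of_excess_eq_zero {x y p q : S} (h : excess x p q = 0) :
    excess x y q ≤ excess x y p := by
  have := dist_triangle q p y
  unfold excess at *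
  linarith

theorem IsGeodesicSpace.exists_dist_eq (hS : IsGeodesicSpace S) (x y : S) {s : ℝ} (hs : 0 ≤ s)
    (hs' : s ≤ dist x y) : ∃ q, dist x q = s ∧ dist q y = dist x y - s := by
  obtain ⟨c, h0, h1, hc⟩ := hS x y
  have hx := hc 0 ⟨le_rfl, dist_nonneg⟩ s ⟨hs, hs'⟩
  have hy := hc s ⟨hs, hs'⟩ (dist x y) ⟨dist_nonneg, le_rfl⟩
  rw [h0, zero_sub, abs_neg, abs_of_nonneg hs] at hx
  rw [h1, abs_sub_comm, abs_of_nonneg (sub_nonneg.2 hs')] at hy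
  exact ⟨c s, hx, hy⟩

theorem FourPointCondition.nonneg (h : FourPointCondition S κ) (x : S) : 0 ≤ κ := by
  simpa only [dist_self, add_zero, max_self, zero_add] using h x x x x

theorem FourPointCondition.min_excess_le (h : FourPointCondition S κ) (x y z p : S) :
    min (excess x y p) (excess y z p) ≤ excess x z p + κ := by
  have := h x z p y
  unfold excess
  rw [dist_comm p y] at *
  rw [dist_comm z p, dist_comm z y] at this
  rw [min_le_iff]
  rcases le_max_iff.1 (sub_le_iff_le_add.2 this) with hm | hm
  · right
    linarith
  · left
    linarith

theorem FourPointCondition.dist_le_of_isNearPosition (h : FourPointCondition S κ)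
    {x y p p' : S} {r r' e e' : ℝ} (hp : IsNearPosition x y r e p)
    (hp' : IsNearPosition x y r' e' p') : dist p p' ≤ |r - r'| + e + e' + κ := by
  obtain ⟨hxp, hpy⟩ := hp
  obtain ⟨hxp', hpy'⟩ := hp'
  have h4 := h x y p p'
  have hmax : max (dist x p + dist y p') (dist x p' + dist y p) ≤
      dist x y + |r - r'| + e + e' := by
    rw [dist_comm y p', dist_comm y p]
    refine max_le ?_ ?_
    · linarith [le_abs_self (r - r')]
    · linarith [neg_le_abs (r - r')]
  linarith

theorem FourPointCondition.exists_center (h : FourPointCondition S κ) (hS : IsGeodesicSpace S)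
    (x y z : S) : ∃ p, excess x y p = 0 ∧ excess y z p ≤ κ ∧ excess x z p ≤ κ := by
  have hy := dist_triangle y x z
  have hz := dist_triangle x z y
  have hx := dist_triangle x y z
  rw [dist_comm y x] at hy
  rw [dist_comm z y] at hz
  obtain ⟨p, hxp, hpy⟩ := hS.exists_dist_eq x y (s := (dist x y + dist x z - dist y z) / 2)
    (by linarith) (by linarith)
  have h4 := h x y p z
  rw [max_eq_left (by rw [dist_comm y p]; linarith)] at h4
  refine ⟨p, ?_, ?_, ?_⟩ <;> unfold excess
  · linarith
  · rw [dist_comm y p]; linarith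
  · linarith

end FourPoint

section Slim

variable {S : Type*} [MetricSpace S] {δ : ℝ} {A : Set S} {x y : S}

theorem IsGeodesicSegment.excess_eq_zero (hA : IsGeodesicSegment A x y) {q : S} (hq : q ∈ A) :
    excess x y q = 0 := by
  obtain ⟨c, h0, h1, hc, rfl⟩ := hA
  obtain ⟨t, ht, rfl⟩ := hq
  have hx := hc 0 ⟨le_rfl, dist_nonneg⟩ t ht
  have hy := hc t ht (dist x y) ⟨dist_nonneg, le_rfl⟩
  rw [h0, zero_sub, abs_neg, abs_of_nonneg ht.1] at hx
  rw [h1, abs_sub_comm, abs_of_nonneg (sub_nonneg.2 ht.2)] at hy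
  unfold excess
  linarith

theorem IsGeodesicSegment.left_mem (hA : IsGeodesicSegment A x y) : x ∈ A := by
  obtain ⟨c, h0, -, -, rfl⟩ := hA
  exact ⟨0, ⟨le_rfl, dist_nonneg⟩, h0⟩

theorem IsGeodesicSegment.right_mem (hA : IsGeodesicSegment A x y) : y ∈ A := by
  obtain ⟨c, -, h1, -, rfl⟩ := hA
  exact ⟨dist x y, ⟨dist_nonneg, le_rfl⟩, h1⟩

theorem IsGeodesicSegment.isPreconnected (hA : IsGeodesicSegment A x y) : IsPreconnected A := by
  obtain ⟨c, -, -, hc, rfl⟩ := hA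
  have hlip : LipschitzOnWith 1 c (Set.Icc 0 (dist x y)) :=
    LipschitzOnWith.of_dist_le_mul fun s hs t ht => by
      rw [hc s hs t ht, NNReal.coe_one, one_mul, Real.dist_eq]
  exact isPreconnected_Icc.image c hlip.continuousOn

theorem IsHyperbolicSpace.isGeodesicSpace (hS : IsHyperbolicSpace S δ) : IsGeodesicSpace S := by
  intro x y
  obtain ⟨A, c, h0, h1, hc, -⟩ := hS.exists_geodesic x y
  exact ⟨c, h0, h1, hc⟩

theorem IsHyperbolicSpace.exists_near_both_sides (hδ : 0 < δ) (hS : IsHyperbolicSpace S δ)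
    {B C : Set S} {z : S} (hA : IsGeodesicSegment A x y) (hB : IsGeodesicSegment B y z)
    (hC : IsGeodesicSegment C z x) :
    ∃ q ∈ A, (∃ u ∈ B, dist q u < 2 * δ) ∧ ∃ v ∈ C, dist q v < 2 * δ := by
  have hclosed (D : Set S) : IsClosed {q | Metric.infDist q D ≤ δ} :=
    isClosed_le (Metric.continuous_infDist_pt D) continuous_const
  have hself {D : Set S} {q : S} (hq : q ∈ D) : Metric.infDist q D ≤ δ :=
    (Metric.infDist_zero_of_mem hq).trans_le hδ.le
  have hcover : A ⊆ {q | Metric.infDist q B ≤ δ} ∪ {q | Metric.infDist q C ≤ δ} := by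
    intro q hq
    obtain ⟨u, hu | hu, hqu⟩ := (hS.slim x y z A B C hA hB hC).1 q hq
    · exact .inl ((Metric.infDist_le_dist_of_mem hu).trans hqu)
    · exact .inr ((Metric.infDist_le_dist_of_mem hu).trans hqu)
  obtain ⟨q, hq, hqB, hqC⟩ := isPreconnected_closed_iff.1 hA.isPreconnected _ _ (hclosed B)
    (hclosed C) hcover ⟨y, hA.right_mem, hself hB.left_mem⟩ ⟨x, hA.left_mem, hself hC.right_mem⟩
  have hlt : δ < 2 * δ := by linarith
  exact ⟨q, hq, (Metric.infDist_lt_iff ⟨y, hB.left_mem⟩).1 (hqB.trans_lt hlt),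
    (Metric.infDist_lt_iff ⟨x, hC.right_mem⟩).1 (hqC.trans_lt hlt)⟩

theorem IsHyperbolicSpace.exists_two_mul_dist_le_excess (hδ : 0 < δ) (hS : IsHyperbolicSpace S δ)
    (hA : IsGeodesicSegment A x y) (p : S) : ∃ q ∈ A, 2 * dist p q ≤ excess x y p + 8 * δ := by
  obtain ⟨B, hB⟩ := hS.exists_geodesic y p
  obtain ⟨C, hC⟩ := hS.exists_geodesic p x
  obtain ⟨q, hq, ⟨u, hu, hqu⟩, v, hv, hqv⟩ := hS.exists_near_both_sides hδ hA hB hC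
  have hyp := excess_le_two_mul_dist_add y p q u
  have hpx := excess_le_two_mul_dist_add p x q v
  have hxy := hA.excess_eq_zero hq
  rw [hB.excess_eq_zero hu] at hyp
  rw [hC.excess_eq_zero hv] at hpx
  refine ⟨q, hq, ?_⟩
  unfold excess at *
  linarith [dist_comm p q, dist_comm q x, dist_comm q y, dist_comm p x, dist_comm y p]

theorem IsHyperbolicSpace.fourPointCondition (hδ : 0 < δ) (hS : IsHyperbolicSpace S δ) :
    FourPointCondition S (10 * δ) := by
  intro x z p y
  obtain ⟨A, hA⟩ := hS.exists_geodesic x z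
  obtain ⟨B, hB⟩ := hS.exists_geodesic z y
  obtain ⟨C, hC⟩ := hS.exists_geodesic y x
  obtain ⟨q, hq, hpq⟩ := hS.exists_two_mul_dist_le_excess hδ hA p
  obtain ⟨q', hq', hqq'⟩ := (hS.slim x z y A B C hA hB hC).1 q hq
  have hpq' : 2 * dist p q' ≤ excess x z p + 10 * δ := by linarith [dist_triangle p q q']
  rw [← sub_le_iff_le_add, le_max_iff]
  rcases hq' with hq' | hq'
  · left
    have := excess_le_two_mul_dist_add z y p q'
    rw [hB.excess_eq_zero hq'] at this
    unfold excess at *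
    linarith [dist_comm z p]
  · right
    have := excess_le_two_mul_dist_add y x p q'
    rw [hC.excess_eq_zero hq'] at this
    unfold excess at *
    linarith [dist_comm y p, dist_comm p x, dist_comm y x, dist_comm z p]

end Slim

/-! ### Displacement of the powers of an isometry -/

theorem dist_pow_smul {M S : Type*} [Monoid M] [PseudoMetricSpace S] [MulAction M S]
    [IsIsometricSMul M S] (g : M) (x : S) {i j : ℕ} (h : i ≤ j) :
    dist (g ^ i • x) (g ^ j • x) = dist x (g ^ (j - i) • x) := by
  rw [← Nat.add_sub_of_le h, pow_add, mul_smul, dist_smul, Nat.add_sub_cancel_left]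

theorem dist_pow_smul_le {M S : Type*} [Monoid M] [PseudoMetricSpace S] [MulAction M S]
    [IsIsometricSMul M S] (g : M) (x : S) (n : ℕ) : dist x (g ^ n • x) ≤ n * dist x (g • x) := by
  induction n with
  | zero => simp
  | succ n ih =>
    have h := dist_triangle x (g ^ n • x) (g ^ (n + 1) • x)
    rw [dist_pow_smul g x (n.le_add_right 1), Nat.add_sub_cancel_left, pow_one] at h
    push_cast
    linarith

section Displacement

variable {Γ S : Type*} [Group Γ] [MetricSpace S] [MulAction Γ S] [IsIsometricSMul Γ S] {κ : ℝ}

theorem translationLength_one (x : S) : translationLength (1 : Γ) x = 0 := by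
  have h := tendsto_translationLength (1 : Γ) x
  simp only [one_pow, one_smul, dist_self, zero_div] at h
  exact tendsto_nhds_unique h tendsto_const_nhds

theorem translationLength_pow (g : Γ) (x : S) (k : ℕ) :
    translationLength (g ^ k) x = k * translationLength g x := by
  rcases Nat.eq_zero_or_pos k with rfl | hk
  · rw [pow_zero, translationLength_one, Nat.cast_zero, zero_mul]
  refine tendsto_nhds_unique (tendsto_translationLength (g ^ k) x)
    ((((tendsto_translationLength g x).comp (tendsto_id.const_mul_atTop' hk)).const_mul
      (k : ℝ)).congr fun n => ?_)
  have hk0 : (k : ℝ) ≠ 0 := by positivity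
  simp only [Function.comp, id, pow_mul, Nat.cast_mul]
  field_simp

theorem translationLength_le_dist (g : Γ) (x : S) : translationLength g x ≤ dist x (g • x) := by
  refine le_of_tendsto (tendsto_translationLength g x) ?_
  filter_upwards [eventually_gt_atTop 0] with n hn
  rw [div_le_iff₀ (by positivity), mul_comm]
  exact dist_pow_smul_le g x n

theorem mul_translationLength_le_dist (g : Γ) (x : S) (n : ℕ) :
    n * translationLength g x ≤ dist x (g ^ n • x) := by
  rw [← translationLength_pow]
  exact translationLength_le_dist _ _

theorem translationLength_nonneg (g : Γ) (x : S) : 0 ≤ translationLength g x :=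
  ge_of_tendsto' (tendsto_translationLength g x) fun n => by positivity

theorem translationLength_pos {g : Γ} (hg : IsLoxodromic S g) (x : S) :
    0 < translationLength g x := by
  obtain ⟨y, hy⟩ := hg
  rwa [translationLength_eq g x y]

theorem pow_injective_of_isLoxodromic {g : Γ} (hg : IsLoxodromic S g) :
    Function.Injective (fun n : ℕ => g ^ n) := by
  obtain ⟨x, hx⟩ := hg
  rw [injective_pow_iff_not_isOfFinOrder, isOfFinOrder_iff_pow_eq_one]
  rintro ⟨n, hn, hgn⟩
  have hnx : (n : ℝ) * translationLength g x = 0 := by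
    rw [← translationLength_pow, hgn, translationLength_one]
  have : (0 : ℝ) < n := by exact_mod_cast hn
  exact (mul_pos this hx).ne' hnx

theorem le_of_tendsto_div_of_add_le_max {a : ℕ → ℝ} {θ τ : ℝ} (h01 : a 0 ≤ a 1)
    (hmax : ∀ n, a (n + 1) + θ ≤ max (a n) (a (n + 2))) (hτ : 0 ≤ τ)
    (hlim : Tendsto (fun n : ℕ => a n / n) atTop (𝓝 τ)) : θ ≤ τ := by
  rcases le_or_gt θ 0 with hθ | hθ
  · exact hθ.trans hτ
  have hstep : ∀ n, a (n + 1) ≤ a (n + 2) - θ := by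
    have hup (n : ℕ) (hn : a n ≤ a (n + 1)) : a (n + 1) ≤ a (n + 2) - θ := by
      rcases le_max_iff.1 (hmax n) with h | h <;> linarith
    intro n
    induction n with
    | zero => exact hup 0 h01
    | succ n ih => exact hup (n + 1) (by linarith)
  have hgrow (n : ℕ) : a 1 + n * θ ≤ a (n + 1) := by
    induction n with
    | zero => simp
    | succ n ih =>
      push_cast
      linarith [hstep n]
  have hlow : Tendsto (fun n : ℕ => θ + (a 1 - θ) / n) atTop (𝓝 (θ + 0)) :=
    tendsto_const_nhds.add (tendsto_const_div_atTop_nhds_zero_nat _)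
  rw [add_zero] at hlow
  refine le_of_tendsto_of_tendsto hlow hlim ?_
  filter_upwards [eventually_gt_atTop 0] with n hn
  obtain ⟨m, rfl⟩ := Nat.exists_eq_succ_of_ne_zero hn.ne'
  have hm : (0 : ℝ) < (m.succ : ℕ) := by positivity
  rw [le_div_iff₀ hm, add_mul, div_mul_cancel₀ _ hm.ne']
  have := hgrow m
  push_cast
  linarith

theorem FourPointCondition.dist_sq_smul_le (h : FourPointCondition S κ) (g : Γ) (x : S) :
    dist x (g ^ 2 • x) ≤ dist x (g • x) + translationLength g x + κ := by
  have key : dist x (g ^ 2 • x) - dist x (g • x) - κ ≤ translationLength g x := by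
    refine le_of_tendsto_div_of_add_le_max (a := fun n => dist x (g ^ n • x)) ?_ (fun n => ?_)
      (translationLength_nonneg g x) (tendsto_translationLength g x)
    · simp only [pow_zero, one_smul, dist_self, dist_nonneg]
    · have h4 := h x (g ^ 2 • x) (g ^ 1 • x) (g ^ (n + 2) • x)
      rw [dist_pow_smul g x (show 1 ≤ n + 2 by omega), dist_pow_smul g x (show 2 ≤ n + 2 by omega),
        dist_comm (g ^ 2 • x) (g ^ 1 • x), dist_pow_smul g x one_le_two, Nat.add_sub_cancel,
        show n + 2 - 1 = n + 1 from rfl, show 2 - 1 = 1 from rfl, pow_one] at h4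
      rw [le_max_iff]
      rcases le_max_iff.1 (sub_le_iff_le_add.2 h4) with h5 | h5
      · left; linarith
      · right; linarith
  linarith

theorem FourPointCondition.exists_dist_smul_le (h : FourPointCondition S κ)
    (hS : IsGeodesicSpace S) (g : Γ) (x : S) :
    ∃ q : S, dist q (g • q) ≤ translationLength g q + 3 * κ := by
  have hκ := h.nonneg x
  have hτ0 := translationLength_nonneg g x
  have hτ1 := translationLength_le_dist g x
  have hsq := h.dist_sq_smul_le g x
  set τ := translationLength g x with hτ
  obtain ⟨q, hxq, hqx⟩ := hS.exists_dist_eq x (g • x) (s := (dist x (g • x) - τ) / 2)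
    (by linarith) (by linarith)
  refine ⟨q, ?_⟩
  rw [translationLength_eq g q x, ← hτ]
  have hgxq : dist (g • x) (g • q) = dist x q := dist_smul ..
  have hgqx : dist (g • q) (g ^ 2 • x) = dist q (g • x) := by rw [pow_two, mul_smul, dist_smul]
  have hgx : dist (g • x) (g ^ 2 • x) = dist x (g • x) := by rw [pow_two, mul_smul, dist_smul]
  have hxgq : dist x (g • q) ≤ dist q (g • x) + 2 * κ := by
    have h4 := h x (g • q) (g • x) (g ^ 2 • x)
    rw [hgqx, hgx, dist_comm (g • q) (g • x), hgxq] at h4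
    rcases le_max_iff.1 (sub_le_iff_le_add.2 h4) with h5 | h5 <;> linarith
  have h4 := h q (g • q) x (g • x)
  rw [dist_comm q x, dist_comm (g • q) (g • x), hgxq, dist_comm (g • q) x] at h4
  rcases le_max_iff.1 (sub_le_iff_le_add.2 h4) with h5 | h5 <;> linarith

theorem exists_forall_mem_window_le_add {b : ℕ → ℝ} {ε : ℝ} (hb : ∀ n, 0 ≤ b n) (hε : 0 < ε)
    (K : ℕ) : ∃ n, K ≤ n ∧ ∀ m, m ≤ n → n ≤ m + K → b m ≤ b n + ε := by
  by_contra! hcon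
  have hK : 0 < K := by
    by_contra hK
    obtain ⟨m, hm0, hm, hlt⟩ := hcon K le_rfl
    obtain rfl : m = K := by omega
    linarith
  set C := ∑ m ∈ Finset.range K, b m
  have hdec (n : ℕ) : b n + (n / K : ℕ) * ε ≤ C := by
    induction n using Nat.strong_induction_on with
    | _ n ih =>
      rcases lt_or_ge n K with hn | hn
      · rw [Nat.div_eq_of_lt hn, Nat.cast_zero, zero_mul, add_zero]
        exact Finset.single_le_sum (fun i _ => hb i) (Finset.mem_range.2 hn)
      · obtain ⟨m, hm, hnm, hlt⟩ := hcon n hn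
        have hmn : m ≠ n := by
          rintro rfl
          linarith
        have hdiv : ((n / K : ℕ) : ℝ) ≤ (m / K : ℕ) + 1 := by
          exact_mod_cast (Nat.div_le_div_right hnm).trans_eq (Nat.add_div_right m hK)
        nlinarith [ih m (lt_of_le_of_ne hm hmn)]
  obtain ⟨k, hk⟩ := exists_nat_gt (C / ε)
  rw [div_lt_iff₀ hε] at hk
  have := hdec (k * K)
  rw [Nat.mul_div_cancel k hK] at this
  linarith [hb (k * K)]

theorem FourPointCondition.dist_pow_sub_smul_le_or (h : FourPointCondition S κ) (hκ : 0 < κ)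
    (g : Γ) (x : S) {i K : ℕ} (hi : i ≤ K) :
    dist x (g ^ (K - i) • x) ≤ dist x (g ^ K • x) - i * translationLength g x + 2 * κ ∨
      dist x (g ^ (K - i) • x) ≤ dist x (g ^ i • x) - K * translationLength g x + 2 * κ := by
  set τ := translationLength g x
  obtain ⟨n, hKn, hn⟩ := exists_forall_mem_window_le_add
    (b := fun n => dist x (g ^ n • x) - n * τ)
    (fun n => sub_nonneg.2 (mul_translationLength_le_dist g x n)) hκ K
  have h4 := h x (g ^ n • x) (g ^ i • x) (g ^ K • x)
  rw [dist_pow_smul g x hi, dist_comm (g ^ n • x) (g ^ K • x), dist_pow_smul g x hKn,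
    dist_comm (g ^ n • x) (g ^ i • x), dist_pow_smul g x (hi.trans hKn)] at h4
  have hni := hn (n - i) (by omega) (by omega)
  have hnK := hn (n - K) (by omega) (by omega)
  rw [Nat.cast_sub (hi.trans hKn)] at hni
  rw [Nat.cast_sub hKn] at hnK
  rcases le_max_iff.1 (sub_le_iff_le_add.2 h4) with h5 | h5
  · right; linarith
  · left; linarith

theorem FourPointCondition.dist_pow_smul_le_of_le (h : FourPointCondition S κ) (hκ : 0 < κ)
    {g : Γ} {x : S} {K : ℕ} (hK : 2 * κ < K * translationLength g x)
    (hx : dist x (g ^ K • x) ≤ K * translationLength g x + 3 * κ) {j : ℕ} (hj : j ≤ K) :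
    dist x (g ^ j • x) ≤ j * translationLength g x + 7 * κ := by
  set τ := translationLength g x
  have hsub := h.dist_pow_sub_smul_le_or hκ g x (Nat.sub_le K j)
  have hj' := h.dist_pow_sub_smul_le_or hκ g x hj
  rw [Nat.sub_sub_self hj, Nat.cast_sub hj] at hsub
  have hj0 : 0 ≤ (j : ℝ) * τ := mul_nonneg j.cast_nonneg (translationLength_nonneg g x)
  rcases hsub with hsub | hsub <;> rcases hj' with hj' | hj' <;> linarith

/-- The points `x, g x, …, g ^ K x` are spaced, up to the error `B`, like points at mutual distance
`τ` on a geodesic. -/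
structure IsQuasiAxis {M S : Type*} [Monoid M] [PseudoMetricSpace S] [SMul M S] (g : M) (x : S)
    (τ B : ℝ) (K : ℕ) : Prop where
  mul_le_dist : ∀ j ≤ K, j * τ ≤ dist x (g ^ j • x)
  dist_le : ∀ j ≤ K, dist x (g ^ j • x) ≤ j * τ + B

theorem FourPointCondition.exists_isQuasiAxis (h : FourPointCondition S κ) (hκ : 0 < κ)
    (hS : IsGeodesicSpace S) (g : Γ) (x : S) {K : ℕ} (hK : 2 * κ < K * translationLength g x) :
    ∃ q : S, IsQuasiAxis g q (translationLength g x) (7 * κ) K := by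
  obtain ⟨q, hq⟩ := h.exists_dist_smul_le hS (g ^ K) x
  rw [translationLength_pow] at hq
  rw [translationLength_eq g x q] at hK ⊢
  exact ⟨q, fun j _ => mul_translationLength_le_dist g q j,
    fun j hj => h.dist_pow_smul_le_of_le hκ hK hq hj⟩

theorem exists_lt_map_eq_of_encard_le {α : Type*} {A : Set α} {N : ℕ} (hA : A.encard ≤ N)
    {u : ℕ → α} (hu : ∀ i ≤ N, u i ∈ A) : ∃ i j, i < j ∧ j ≤ N ∧ u i = u j := by
  have hcard : A.encard < (Set.Iic N).encard := by
    rw [← Finset.coe_Iic, Set.encard_coe_eq_coe_finsetCard, Nat.card_Iic]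
    exact hA.trans_lt (by exact_mod_cast N.lt_succ_self)
  obtain ⟨i, hi, j, hj, hij, he⟩ := Set.exists_ne_map_eq_of_encard_lt_of_maps_to hcard hu
  rcases hij.lt_or_gt with hlt | hlt
  · exact ⟨i, j, hlt, hj, he⟩
  · exact ⟨j, i, hlt, hi, he.symm⟩

theorem IsAcylindrical.exists_translationLength_ge (hΓ : IsAcylindrical Γ S)
    (h : FourPointCondition S κ) (hκ : 0 < κ) (hS : IsGeodesicSpace S) :
    ∃ τ₀ : ℝ, 0 < τ₀ ∧ ∀ g : Γ, IsLoxodromic S g → ∀ x : S, τ₀ ≤ translationLength g x := by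
  obtain ⟨R, N, hR, hN, hRN⟩ := hΓ (8 * κ) (by positivity)
  have hN' : (0 : ℝ) < N := by exact_mod_cast hN
  refine ⟨κ / N, by positivity, fun g hg x => ?_⟩
  by_contra! hlt
  have hpos := translationLength_pos hg x
  set τ := translationLength g x with hτ
  rw [lt_div_iff₀ hN'] at hlt
  obtain ⟨K, hK⟩ := exists_nat_gt ((R + 2 * κ) / τ)
  rw [div_lt_iff₀ hpos] at hK
  have hNτ : (0 : ℝ) ≤ N * τ := by positivity
  have hKN : R + 2 * κ < ((K + N : ℕ) : ℝ) * τ := by push_cast; linarith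
  obtain ⟨q, hq⟩ := h.exists_isQuasiAxis hκ hS g x (show 2 * κ < (K + N : ℕ) * τ by linarith)
  have hfar : R ≤ dist q (g ^ (K + N) • q) := by linarith [hq.mul_le_dist _ le_rfl]
  have hsmall : ∀ i ≤ N, dist q (g ^ i • q) ≤ 8 * κ := by
    intro i hi
    have hiτ : (i : ℝ) * τ ≤ N * τ := by gcongr
    linarith [hq.dist_le i (by omega)]
  obtain ⟨i, j, hij, -, he⟩ := exists_lt_map_eq_of_encard_le (hRN _ _ hfar)
    (u := fun i => g ^ i) fun i hi => ⟨hsmall i hi, by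
      rw [← mul_smul, ← pow_add, dist_pow_smul g q (Nat.le_add_left _ _), Nat.add_sub_cancel]
      exact hsmall i hi⟩
  exact hij.ne (pow_injective_of_isLoxodromic hg he)

end Displacement

/-! ### Stability of quasi-geodesics -/

theorem eventually_mul_add_le_two_pow (a b : ℝ) : ∀ᶠ k : ℕ in atTop, a * k + b ≤ 2 ^ k := by
  have hk : (fun k : ℕ => (k : ℝ)) =o[atTop] fun k => (2 : ℝ) ^ k :=
    isLittleO_coe_const_pow_of_one_lt one_lt_two
  have hb : (fun _ : ℕ => b) =o[atTop] fun k => (2 : ℝ) ^ k :=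
    Asymptotics.isLittleO_const_left.2 <| .inr <|
      tendsto_norm_atTop_atTop.comp (tendsto_pow_atTop_atTop_of_one_lt one_lt_two)
  filter_upwards [((hk.const_mul_left a).add hb).def one_pos] with k h
  rw [one_mul, Real.norm_of_nonneg (by positivity : (0 : ℝ) ≤ 2 ^ k)] at h
  exact (le_abs_self _).trans h

theorem exists_forall_le_of_log_growth {a : ℝ} (ha : 0 ≤ a) (b α β : ℝ) :
    ∃ D : ℝ, ∀ M : ℝ, (∀ k : ℕ, a * M + b ≤ 2 ^ k → M ≤ α + k * β) → M ≤ D := by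
  obtain ⟨k₀, hk₀⟩ := eventually_atTop.1
    (eventually_mul_add_le_two_pow (a * β) (a * (α + β) + b))
  refine ⟨α + k₀ * β, fun M hM => ?_⟩
  obtain ⟨k₁, hk₁, hle⟩ :=
    ((eventually_mul_add_le_two_pow 0 (a * M + b)).and (eventually_ge_atTop k₀)).exists
  refine Nat.decreasingInduction' (P := fun k => M ≤ α + k * β) (fun k _ hk ih => hM k ?_) hle
    (hM k₁ (by linarith))
  calc a * M + b ≤ a * (α + (k + 1 : ℕ) * β) + b := by gcongr
    _ = a * β * k + (a * (α + β) + b) := by push_cast; ring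
    _ ≤ 2 ^ k := hk₀ k hk

section Morse

variable {S : Type*} [PseudoMetricSpace S] {κ : ℝ}

theorem FourPointCondition.exists_two_mul_dist_le_of_lipschitzOnWith (h : FourPointCondition S κ)
    {K : ℝ≥0} {f : ℝ → S} {a b : ℝ} (hab : a ≤ b) (hf : LipschitzOnWith K f (Set.Icc a b)) {k : ℕ}
    (hk : b - a ≤ 2 ^ k) (p : S) :
    ∃ t ∈ Set.Icc a b, 2 * dist p (f t) ≤ excess (f a) (f b) p + k * κ + 2 * K := by
  induction k generalizing a b with
  | zero =>
    have ha : a ∈ Set.Icc a b := ⟨le_rfl, hab⟩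
    have hlip := hf.dist_le_mul a ha b ⟨hab, le_rfl⟩
    rw [dist_comm a b, Real.dist_eq, abs_of_nonneg (sub_nonneg.2 hab)] at hlip
    have hK : (K : ℝ) * (b - a) ≤ K := by
      simpa only [pow_zero, mul_one] using mul_le_mul_of_nonneg_left hk K.coe_nonneg
    have := dist_triangle p (f b) (f a)
    refine ⟨a, ha, ?_⟩
    unfold excess
    rw [dist_comm (f a) p, Nat.cast_zero, zero_mul]
    linarith [dist_comm (f a) (f b)]
  | succ k ih =>
    rw [pow_succ] at hk
    have ham : a ≤ (a + b) / 2 := by linarith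
    have hmb : (a + b) / 2 ≤ b := by linarith
    rcases min_le_iff.1 (h.min_excess_le (f a) (f ((a + b) / 2)) (f b) p) with hex | hex
    · obtain ⟨t, ht, hd⟩ := ih ham (hf.mono (Set.Icc_subset_Icc_right hmb)) (by linarith)
      refine ⟨t, Set.Icc_subset_Icc_right hmb ht, ?_⟩
      push_cast
      linarith
    · obtain ⟨t, ht, hd⟩ := ih hmb (hf.mono (Set.Icc_subset_Icc_left ham)) (by linarith)
      refine ⟨t, Set.Icc_subset_Icc_left ham ht, ?_⟩
      push_cast
      linarith

theorem IsGeodesicSpace.exists_anchor (hS : IsGeodesicSpace S) {F : Set S} {x p : S} {M : ℝ}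
    (hM : 0 ≤ M) (hx : x ∈ F) (hnear : ∀ q, excess x p q = 0 → ∃ r ∈ F, dist q r ≤ M + 1)
    (hfar : ∀ r ∈ F, M - 1 ≤ dist p r) :
    ∃ q, excess x p q = 0 ∧ dist q p ≤ 2 * M ∧
      ∃ r ∈ F, dist q r ≤ M + 1 ∧ 2 * M - 2 ≤ excess q r p := by
  rcases le_or_gt (2 * M) (dist x p) with hle | hlt
  · obtain ⟨q, hxq, hqp⟩ := hS.exists_dist_eq x p (sub_nonneg.2 hle) (by linarith)
    have hq : excess x p q = 0 := by unfold excess; linarith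
    obtain ⟨r, hr, hqr⟩ := hnear q hq
    refine ⟨q, hq, by linarith, r, hr, hqr, ?_⟩
    have := hfar r hr
    unfold excess
    linarith
  · have := hfar x hx
    refine ⟨x, ?_, hlt.le, x, hx, ?_, ?_⟩
    · unfold excess; simp
    · rw [dist_self]; linarith
    · unfold excess
      rw [dist_self, dist_comm x p]
      linarith

theorem FourPointCondition.exists_short_chord (h : FourPointCondition S κ)
    (hS : IsGeodesicSpace S) {F : Set S} {x y p : S} {M : ℝ} (hM : 0 ≤ M) (hx : x ∈ F)
    (hy : y ∈ F) (hp : excess x y p ≤ κ)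
    (hnear : ∀ q, excess x y q ≤ κ → ∃ r ∈ F, dist q r ≤ M + 1)
    (hfar : ∀ r ∈ F, M - 1 ≤ dist p r) :
    M ≤ 1 + 3 / 2 * κ ∨
      ∃ r₁ ∈ F, ∃ r₂ ∈ F, dist r₁ r₂ ≤ 6 * M + 2 ∧ excess r₁ r₂ p ≤ 3 * κ := by
  have hκ := h.nonneg p
  obtain ⟨q₁, hq₁, hq₁p, r₁, hr₁, hqr₁, he₁⟩ := hS.exists_anchor hM hx
    (fun q hq => hnear q ((excess_le_of_excess_eq_zero hq).trans hp)) hfar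
  obtain ⟨q₂, hq₂, hq₂p, r₂, hr₂, hqr₂, he₂⟩ := hS.exists_anchor hM hy
    (fun q hq => hnear q (by
      rw [excess_comm] at hp ⊢
      exact (excess_le_of_excess_eq_zero hq).trans hp)) hfar
  have hq : excess q₁ q₂ p ≤ κ := by
    have := dist_triangle4 x q₁ q₂ y
    unfold excess at *
    linarith [dist_comm p q₂, dist_comm q₂ y, dist_comm y p]
  have hends : dist r₁ r₂ ≤ 6 * M + 2 := by
    have := dist_triangle4 r₁ q₁ q₂ r₂
    have := dist_triangle_right q₁ q₂ p
    linarith [dist_comm q₁ r₁]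
  rcases min_le_iff.1 (h.min_excess_le q₁ r₁ q₂ p) with hex | hex
  · left; linarith
  · rcases min_le_iff.1 (h.min_excess_le r₁ r₂ q₂ p) with hex' | hex'
    · right; exact ⟨r₁, hr₁, r₂, hr₂, hends, by linarith⟩
    · left; linarith [excess_comm r₂ q₂ p]

/-- A `K`-Lipschitz quasi-geodesic, parametrized by `[0, ℓ]`. -/
structure IsQuasiGeodesic (K lam : ℝ≥0) (C : ℝ) (f : ℝ → S) (ℓ : ℝ) : Prop where
  lipschitzOnWith : LipschitzOnWith K f (Set.Icc 0 ℓ)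
  dist_le : ∀ s ∈ Set.Icc 0 ℓ, ∀ t ∈ Set.Icc 0 ℓ, dist s t ≤ lam * dist (f s) (f t) + C

theorem IsQuasiGeodesic.exists_two_mul_dist_le (h : FourPointCondition S κ) {K lam : ℝ≥0}
    {C ℓ : ℝ} {f : ℝ → S} (hf : IsQuasiGeodesic K lam C f ℓ) {a b : ℝ} (ha : a ∈ Set.Icc 0 ℓ)
    (hb : b ∈ Set.Icc 0 ℓ) {k : ℕ} (hk : lam * dist (f a) (f b) + C ≤ 2 ^ k) (p : S) :
    ∃ t ∈ Set.Icc 0 ℓ, 2 * dist p (f t) ≤ excess (f a) (f b) p + k * κ + 2 * K := by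
  wlog hab : a ≤ b generalizing a b
  · rw [excess_comm]
    exact this hb ha (by rwa [dist_comm]) (le_of_not_ge hab)
  have hlen := hf.dist_le a ha b hb
  rw [dist_comm, Real.dist_eq, abs_of_nonneg (sub_nonneg.2 hab)] at hlen
  have hsub : Set.Icc a b ⊆ Set.Icc 0 ℓ := Set.Icc_subset_Icc ha.1 hb.2
  obtain ⟨t, ht, hd⟩ := h.exists_two_mul_dist_le_of_lipschitzOnWith hab
    (hf.lipschitzOnWith.mono hsub) (hlen.trans hk) p
  exact ⟨t, hsub ht, hd⟩

/-- A quasi-geodesic that stays at distance about `M` from `p` has a chord of length `O(M)` passing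
near `p`, hence `M = O(log M)` by repeated halving of the piece over this chord. -/
theorem FourPointCondition.exists_forall_le_of_isQuasiGeodesic (h : FourPointCondition S κ)
    (hS : IsGeodesicSpace S) (K lam : ℝ≥0) (C : ℝ) :
    ∃ D : ℝ, ∀ (f : ℝ → S) (ℓ : ℝ), 0 ≤ ℓ → IsQuasiGeodesic K lam C f ℓ → ∀ (p : S) (M : ℝ),
      0 ≤ M → excess (f 0) (f ℓ) p ≤ κ →
      (∀ q, excess (f 0) (f ℓ) q ≤ κ → ∃ r ∈ f '' Set.Icc 0 ℓ, dist q r ≤ M + 1) →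
      (∀ r ∈ f '' Set.Icc 0 ℓ, M - 1 ≤ dist p r) → M ≤ D := by
  obtain ⟨D, hD⟩ := exists_forall_le_of_log_growth (a := 6 * lam) (by positivity) (2 * lam + C)
    (1 + K + 3 / 2 * κ) (κ / 2)
  refine ⟨D, fun f ℓ hℓ hf p M hM hp hnear hfar => hD M fun k hk => ?_⟩
  have hkκ : 0 ≤ k * (κ / 2) := mul_nonneg k.cast_nonneg (div_nonneg (h.nonneg p) zero_le_two)
  rcases h.exists_short_chord hS hM (Set.mem_image_of_mem f (Set.left_mem_Icc.2 hℓ))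
    (Set.mem_image_of_mem f (Set.right_mem_Icc.2 hℓ)) hp hnear hfar
    with hle | ⟨_, ⟨a, ha, rfl⟩, _, ⟨b, hb, rfl⟩, hab, hex⟩
  · linarith
  have hlen : lam * dist (f a) (f b) + C ≤ 2 ^ k :=
    calc lam * dist (f a) (f b) + C ≤ lam * (6 * M + 2) + C := by gcongr
      _ = 6 * lam * M + (2 * lam + C) := by ring
      _ ≤ 2 ^ k := hk
  obtain ⟨t, ht, hd⟩ := hf.exists_two_mul_dist_le h ha hb hlen p
  linarith [hfar (f t) ⟨t, ht, rfl⟩]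

theorem FourPointCondition.exists_dist_le_of_isQuasiGeodesic (h : FourPointCondition S κ)
    (hS : IsGeodesicSpace S) (K lam : ℝ≥0) (C : ℝ) :
    ∃ D : ℝ, ∀ (f : ℝ → S) (ℓ : ℝ), 0 ≤ ℓ → IsQuasiGeodesic K lam C f ℓ →
      ∀ p, excess (f 0) (f ℓ) p ≤ κ → ∃ t ∈ Set.Icc 0 ℓ, dist p (f t) ≤ D := by
  obtain ⟨D, hD⟩ := h.exists_forall_le_of_isQuasiGeodesic hS K lam C
  refine ⟨D + 1, fun f ℓ hℓ hf p hp => ?_⟩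
  set F := f '' Set.Icc 0 ℓ
  have h0 : f 0 ∈ F := ⟨0, ⟨le_rfl, hℓ⟩, rfl⟩
  set E := (Metric.infDist · F) '' {q | excess (f 0) (f ℓ) q ≤ κ}
  have hbdd : BddAbove E := by
    refine ⟨dist (f 0) (f ℓ) + κ, ?_⟩
    rintro _ ⟨q, hq : excess _ _ _ ≤ κ, rfl⟩
    have hle : Metric.infDist q F ≤ dist q (f 0) := Metric.infDist_le_dist_of_mem h0
    unfold excess at hq
    linarith [dist_comm q (f 0), dist_nonneg (x := q) (y := f ℓ)]
  have hle (q : S) (hq : excess (f 0) (f ℓ) q ≤ κ) : Metric.infDist q F ≤ sSup E :=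
    le_csSup hbdd ⟨q, hq, rfl⟩
  have hnear (q : S) (hq : excess (f 0) (f ℓ) q ≤ κ) : ∃ r ∈ F, dist q r ≤ sSup E + 1 := by
    obtain ⟨r, hr, hqr⟩ := (Metric.infDist_lt_iff ⟨f 0, h0⟩).1
      ((hle q hq).trans_lt (lt_add_one _))
    exact ⟨r, hr, hqr.le⟩
  obtain ⟨_, ⟨p₀, hp₀, rfl⟩, hlt⟩ :=
    exists_lt_of_lt_csSup (⟨_, p, hp, rfl⟩ : E.Nonempty) (sub_lt_self _ one_pos)
  have hsup : sSup E ≤ D := hD f ℓ hℓ hf p₀ (sSup E)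
    (Metric.infDist_nonneg.trans (hle p hp)) hp₀ hnear
    fun r hr => hlt.le.trans (Metric.infDist_le_dist_of_mem hr)
  obtain ⟨_, ⟨t, ht, rfl⟩, hpt⟩ := hnear p hp
  exact ⟨t, ht, by linarith⟩

end Morse

/-! ### Directed distances -/

theorem lipschitzOnWith_Icc_of_Icc {S : Type*} [PseudoMetricSpace S] {K : ℝ≥0} {f : ℝ → S}
    {a b c : ℝ} (hab : LipschitzOnWith K f (Set.Icc a b))
    (hbc : LipschitzOnWith K f (Set.Icc b c)) : LipschitzOnWith K f (Set.Icc a c) := by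
  refine LipschitzOnWith.of_dist_le_mul fun s hs t ht => ?_
  wlog hst : s ≤ t generalizing s t
  · rw [dist_comm (f s), dist_comm s]
    exact this t ht s hs (le_of_not_ge hst)
  rcases le_total t b with htb | hbt
  · exact hab.dist_le_mul s ⟨hs.1, hst.trans htb⟩ t ⟨ht.1, htb⟩
  rcases le_total b s with hbs | hsb
  · exact hbc.dist_le_mul s ⟨hbs, hs.2⟩ t ⟨hbt, ht.2⟩
  have hsum : dist s t = dist s b + dist b t := by
    simp only [Real.dist_eq, abs_of_nonpos (sub_nonpos.2 hst), abs_of_nonpos (sub_nonpos.2 hsb),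
      abs_of_nonpos (sub_nonpos.2 hbt)]
    ring
  rw [hsum, mul_add]
  exact (dist_triangle (f s) (f b) (f t)).trans (add_le_add
    (hab.dist_le_mul s ⟨hs.1, hsb⟩ b ⟨hs.1.trans hsb, le_rfl⟩)
    (hbc.dist_le_mul b ⟨le_rfl, hbt.trans ht.2⟩ t ⟨hbt, ht.2⟩))

/-- The path following `f` until time `c`, and then `g`. -/
noncomputable def concat {S : Type*} (c : ℝ) (f g : ℝ → S) (t : ℝ) : S :=
  if t ≤ c then f t else g (t - c)

theorem concat_of_le {S : Type*} {c t : ℝ} (f g : ℝ → S) (ht : t ≤ c) : concat c f g t = f t :=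
  if_pos ht

theorem concat_add {S : Type*} {c t : ℝ} {f g : ℝ → S} (hfg : f c = g 0) (ht : 0 ≤ t) :
    concat c f g (c + t) = g t := by
  rcases ht.eq_or_lt with rfl | ht
  · rw [add_zero, concat_of_le f g le_rfl, hfg]
  · rw [concat, if_neg (by linarith), add_sub_cancel_left]

theorem lipschitzOnWith_concat {S : Type*} [PseudoMetricSpace S] {K : ℝ≥0} {c c' : ℝ}
    {f g : ℝ → S} (hf : LipschitzOnWith K f (Set.Icc 0 c))
    (hg : LipschitzOnWith K g (Set.Icc 0 c')) (hfg : f c = g 0) :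
    LipschitzOnWith K (concat c f g) (Set.Icc 0 (c + c')) := by
  refine lipschitzOnWith_Icc_of_Icc (b := c) (LipschitzOnWith.of_dist_le_mul ?_)
    (LipschitzOnWith.of_dist_le_mul ?_)
  · intro s hs t ht
    rw [concat_of_le f g hs.2, concat_of_le f g ht.2]
    exact hf.dist_le_mul s hs t ht
  · rintro s ⟨hs, hs'⟩ t ⟨ht, ht'⟩
    have h := hg.dist_le_mul (s - c) ⟨by linarith, by linarith⟩ (t - c) ⟨by linarith, by linarith⟩
    rw [← concat_add hfg (sub_nonneg.2 hs), ← concat_add hfg (sub_nonneg.2 ht), dist_sub_right] at h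
    simpa only [add_sub_cancel] using h

/-- `φ` is additive up to the error `D`. -/
def IsQuasimorphism {G : Type*} [Mul G] (φ : G → ℝ) (D : ℝ) : Prop :=
  ∀ a b, |φ (a * b) - φ a - φ b| ≤ D

section DirectedDist

variable {S : Type*} [PseudoMetricSpace S] {κ C Δ : ℝ} {ρ : S → S → ℝ}

/-- A possibly asymmetric distance that differs from the metric by at most a factor of `2`. -/
structure IsDirectedDist (ρ : S → S → ℝ) : Prop where
  triangle : ∀ x y z, ρ x z ≤ ρ x y + ρ y z
  le_dist : ∀ x y, ρ x y ≤ dist x y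
  dist_le : ∀ x y, dist x y ≤ 2 * ρ x y

/-- Up to the error `C`, the directed distance `ρ` is additive along geodesics of the metric, or
more generally at the points of excess at most `κ`. -/
def AlmostAdditive (κ C : ℝ) (ρ : S → S → ℝ) : Prop :=
  ∀ x y p, excess x y p ≤ κ → ρ x p + ρ p y ≤ ρ x y + C

/-- A path from `f 0` to `f c` along which time bounds the directed distance `ρ` to the end points,
up to the error `Δ` at intermediate points. -/
structure IsCostPath (ρ : S → S → ℝ) (Δ c : ℝ) (f : ℝ → S) : Prop where
  nonneg : 0 ≤ c
  lipschitzOnWith : LipschitzOnWith 2 f (Set.Icc 0 c)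
  le_cost : ρ (f 0) (f c) ≤ c
  left_le : ∀ t ∈ Set.Icc 0 c, ρ (f 0) (f t) ≤ t + Δ
  right_le : ∀ t ∈ Set.Icc 0 c, ρ (f t) (f c) ≤ c - t + Δ

/-- Any two points are joined by a path of almost minimal cost. -/
def IsCoarselyGeodesic (ρ : S → S → ℝ) (Δ : ℝ) : Prop :=
  ∀ x y, ∃ c f, c ≤ ρ x y + 1 ∧ f 0 = x ∧ f c = y ∧ IsCostPath ρ Δ c f

theorem IsGeodesicSpace.exists_constant_speed (hS : IsGeodesicSpace S) {x y : S} {c : ℝ}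
    (hc : 0 ≤ c) (hxy : c = 0 → dist x y = 0) : ∃ f : ℝ → S, f 0 = x ∧ f c = y ∧
      ∀ s ∈ Set.Icc 0 c, ∀ t ∈ Set.Icc 0 c, dist (f s) (f t) = dist x y / c * |s - t| := by
  obtain ⟨γ, h0, h1, hγ⟩ := hS x y
  have hv : 0 ≤ dist x y / c := div_nonneg dist_nonneg hc
  have hvc : dist x y / c * c = dist x y := div_mul_cancel_of_imp hxy
  have hmem {t : ℝ} (ht : t ∈ Set.Icc 0 c) : dist x y / c * t ∈ Set.Icc 0 (dist x y) :=
    ⟨mul_nonneg hv ht.1, (mul_le_mul_of_nonneg_left ht.2 hv).trans_eq hvc⟩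
  refine ⟨fun t => γ (dist x y / c * t), ?_, ?_, fun s hs t ht => ?_⟩
  · simp only [mul_zero, h0]
  · simp only [hvc, h1]
  · rw [hγ _ (hmem hs) _ (hmem ht), ← mul_sub, abs_mul, abs_of_nonneg hv]

theorem IsDirectedDist.exists_isCostPath (hρ : IsDirectedDist ρ) (hS : IsGeodesicSpace S)
    (hΔ : 0 ≤ Δ) {x y : S} {c : ℝ} (hc : dist x y ≤ 2 * c) (hcΔ : dist x y ≤ c + Δ)
    (hρc : ρ x y ≤ c) : ∃ f, f 0 = x ∧ f c = y ∧ IsCostPath ρ Δ c f := by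
  have hxy : 0 ≤ dist x y := dist_nonneg
  have hc0 : 0 ≤ c := by linarith
  have hvc : dist x y / c * c = dist x y := div_mul_cancel_of_imp fun h => by linarith
  obtain ⟨f, rfl, rfl, hf⟩ := hS.exists_constant_speed hc0 (x := x) (y := y) fun h => by linarith
  set v := dist (f 0) (f c) / c
  have hv : v ≤ 2 := div_le_of_le_mul₀ hc0 zero_le_two hc
  have hslow {t : ℝ} (ht : 0 ≤ t) (htc : t ≤ c) : v * t ≤ t + Δ := by
    rcases le_total v 1 with hv1 | hv1
    · linarith [mul_le_mul_of_nonneg_right hv1 ht]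
    · linarith [mul_le_mul_of_nonneg_left htc (sub_nonneg.2 hv1)]
  refine ⟨f, rfl, rfl, hc0, LipschitzOnWith.of_dist_le_mul fun s hs t ht => ?_, hρc,
    fun t ht => ?_, fun t ht => ?_⟩
  · rw [hf s hs t ht]
    exact mul_le_mul_of_nonneg_right hv (abs_nonneg _)
  · have := hρ.le_dist (f 0) (f t)
    rw [hf 0 (Set.left_mem_Icc.2 hc0) t ht, zero_sub, abs_neg, abs_of_nonneg ht.1] at this
    exact this.trans (hslow ht.1 ht.2)
  · have := hρ.le_dist (f t) (f c)
    rw [hf t ht c (Set.right_mem_Icc.2 hc0), abs_sub_comm, abs_of_nonneg (sub_nonneg.2 ht.2)]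
      at this
    exact this.trans (hslow (sub_nonneg.2 ht.2) (sub_le_self _ ht.1))

theorem IsCostPath.concat (hρ : IsDirectedDist ρ) {c c' : ℝ} {f g : ℝ → S}
    (hf : IsCostPath ρ Δ c f) (hg : IsCostPath ρ Δ c' g) (hfg : f c = g 0) :
    IsCostPath ρ Δ (c + c') (concat c f g) := by
  have h0 : SclGap.concat c f g 0 = f 0 := concat_of_le f g hf.nonneg
  have h1 : SclGap.concat c f g (c + c') = g c' := concat_add hfg hg.nonneg
  have hfirst := hf.le_cost
  have hsecond := hg.le_cost
  rw [← hfg] at hsecond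
  refine ⟨add_nonneg hf.nonneg hg.nonneg,
    lipschitzOnWith_concat hf.lipschitzOnWith hg.lipschitzOnWith hfg, ?_, ?_, ?_⟩
  · rw [h0, h1]
    linarith [hρ.triangle (f 0) (f c) (g c')]
  · rintro t ⟨ht, ht'⟩
    rw [h0]
    rcases le_total t c with htc | hct
    · rw [concat_of_le f g htc]
      exact hf.left_le t ⟨ht, htc⟩
    · obtain ⟨s, rfl⟩ := exists_add_of_le hct
      rw [concat_add hfg (by linarith)]
      have := hg.left_le s ⟨by linarith, by linarith⟩
      rw [← hfg] at this
      linarith [hρ.triangle (f 0) (f c) (g s)]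
  · rintro t ⟨ht, ht'⟩
    rw [h1]
    rcases le_total t c with htc | hct
    · rw [concat_of_le f g htc]
      have := hf.right_le t ⟨ht, htc⟩
      linarith [hρ.triangle (f t) (f c) (g c')]
    · obtain ⟨s, rfl⟩ := exists_add_of_le hct
      rw [concat_add hfg (by linarith)]
      linarith [hg.right_le s ⟨by linarith, by linarith⟩]

theorem IsCostPath.isQuasiGeodesic (hρ : IsDirectedDist ρ) {c : ℝ} {f : ℝ → S}
    (hf : IsCostPath ρ Δ c f) (hc : c ≤ ρ (f 0) (f c) + 1) :
    IsQuasiGeodesic 2 1 (1 + 2 * Δ) f c := by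
  refine ⟨hf.lipschitzOnWith, fun s hs t ht => ?_⟩
  wlog hst : s ≤ t generalizing s t
  · rw [dist_comm s, dist_comm (f s)]
    exact this t ht s hs (le_of_not_ge hst)
  rw [dist_comm, Real.dist_eq, abs_of_nonneg (sub_nonneg.2 hst), NNReal.coe_one, one_mul]
  have := hf.left_le s hs
  have := hf.right_le t ht
  linarith [hρ.triangle (f 0) (f s) (f c), hρ.triangle (f s) (f t) (f c),
    hρ.le_dist (f s) (f t)]

theorem FourPointCondition.exists_almostAdditive (h : FourPointCondition S κ)
    (hS : IsGeodesicSpace S) (Δ : ℝ) :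
    ∃ C, ∀ ρ : S → S → ℝ, IsDirectedDist ρ → IsCoarselyGeodesic ρ Δ → AlmostAdditive κ C ρ := by
  obtain ⟨D, hD⟩ := h.exists_dist_le_of_isQuasiGeodesic hS 2 1 (1 + 2 * Δ)
  refine ⟨1 + 2 * Δ + 2 * D, fun ρ hρ hgeo x y p hp => ?_⟩
  obtain ⟨c, f, hc, rfl, rfl, hf⟩ := hgeo x y
  obtain ⟨t, ht, hpt⟩ := hD f c hf.nonneg (hf.isQuasiGeodesic hρ hc) p hp
  have := hf.left_le t ht
  have := hf.right_le t ht
  have := hρ.le_dist p (f t)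
  have := hρ.le_dist (f t) p
  linarith [hρ.triangle (f 0) (f t) p, hρ.triangle p (f t) (f c), dist_comm p (f t)]

theorem AlmostAdditive.excess_le (hC : AlmostAdditive κ C ρ) (h : FourPointCondition S κ)
    (hS : IsGeodesicSpace S) (hρ : IsDirectedDist ρ) {x y q : S} {E : ℝ}
    (hq : ρ x q + ρ q y ≤ ρ x y + E) : excess x y q ≤ κ + 2 * (2 * C + E) := by
  obtain ⟨p, hxq, hqy, hxy⟩ := h.exists_center hS x q y
  have := hC x q p (hxq.trans_le (h.nonneg x))
  have := hC q y p hqy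
  have := excess_le_two_mul_dist_add x y q p
  linarith [hρ.triangle x p y, hρ.dist_le p q, hρ.dist_le q p, dist_comm p q]

theorem AlmostAdditive.abs_antisymmetrization_le (hC : AlmostAdditive κ C ρ)
    (h : FourPointCondition S κ) (hS : IsGeodesicSpace S) (hρ : IsDirectedDist ρ) (x y z : S) :
    |(ρ x z - ρ z x) - (ρ x y - ρ y x) - (ρ y z - ρ z y)| ≤ 3 * C := by
  obtain ⟨p, hxy, hyz, hxz⟩ := h.exists_center hS x y z
  replace hxy := hxy.trans_le (h.nonneg x)
  have additive {a b : S} (hab : excess a b p ≤ κ) :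
      0 ≤ ρ a p + ρ p b - ρ a b ∧ ρ a p + ρ p b - ρ a b ≤ C :=
    ⟨by linarith [hρ.triangle a p b], by linarith [hC a b p hab]⟩
  have symm {a b : S} (hab : excess a b p ≤ κ) : excess b a p ≤ κ := by rwa [excess_comm]
  have := additive hxy
  have := additive hyz
  have := additive hxz
  have := additive (symm hxy)
  have := additive (symm hyz)
  have := additive (symm hxz)
  rw [abs_le]
  constructor <;> linarith

theorem AlmostAdditive.isQuasimorphism {Γ : Type*} [Monoid Γ] [MulAction Γ S]
    (hC : AlmostAdditive κ C ρ) (h : FourPointCondition S κ) (hS : IsGeodesicSpace S)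
    (hρ : IsDirectedDist ρ) (hinv : ∀ (g : Γ) x y, ρ (g • x) (g • y) = ρ x y) (x : S) :
    IsQuasimorphism (fun g : Γ => ρ x (g • x) - ρ (g • x) x) (3 * C) := by
  intro a b
  have := hC.abs_antisymmetrization_le h hS hρ x (a • x) ((a * b) • x)
  rwa [mul_smul, hinv, hinv, ← mul_smul] at this

end DirectedDist

/-! ### Discounted distances -/

section Routes

variable {Γ S : Type*} [Group Γ] [MetricSpace S] [MulAction Γ S]

variable (Γ) in
/-- A route from `x` of given end point and total cost, where one may walk at the cost of the
distance, and jump from a translate of `x₀` to the same translate of `y₀` at the cost of the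
distance minus `Δ`. -/
inductive Route (x₀ y₀ : S) (Δ : ℝ) (x : S) : S → ℝ → Prop
  | nil : Route x₀ y₀ Δ x x 0
  | walk {y : S} {c : ℝ} (z : S) : Route x₀ y₀ Δ x y c → Route x₀ y₀ Δ x z (c + dist y z)
  | jump {c : ℝ} (γ : Γ) : Route x₀ y₀ Δ x (γ • x₀) c →
      Route x₀ y₀ Δ x (γ • y₀) (c + (dist x₀ y₀ - Δ))

variable (Γ) in
/-- The infimal cost of a route from `x` to `y`. -/
noncomputable def routeDist (x₀ y₀ : S) (Δ : ℝ) (x y : S) : ℝ :=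
  sInf {c | Route Γ x₀ y₀ Δ x y c}

variable {x₀ y₀ x y z : S} {Δ c c' : ℝ}

theorem Route.of_dist (x y : S) : Route Γ x₀ y₀ Δ x y (dist x y) :=
  zero_add (dist x y) ▸ Route.nil.walk y

theorem Route.of_jump (γ : Γ) : Route Γ x₀ y₀ Δ (γ • x₀) (γ • y₀) (dist x₀ y₀ - Δ) :=
  zero_add (dist x₀ y₀ - Δ) ▸ Route.nil.jump γ

theorem Route.trans (h : Route Γ x₀ y₀ Δ x y c) (h' : Route Γ x₀ y₀ Δ y z c') :
    Route Γ x₀ y₀ Δ x z (c + c') := by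
  induction h' with
  | nil => rwa [add_zero]
  | walk z _ ih => exact add_assoc c _ _ ▸ ih.walk z
  | jump γ _ ih => exact add_assoc c _ _ ▸ ih.jump γ

theorem Route.dist_le_or_exists_jump (h : Route Γ x₀ y₀ Δ x y c) :
    dist x y ≤ c ∨ ∃ (γ : Γ) (c₁ c₂ : ℝ), Route Γ x₀ y₀ Δ x (γ • x₀) c₁ ∧
      Route Γ x₀ y₀ Δ (γ • y₀) y c₂ ∧ c₁ + (dist x₀ y₀ - Δ) + c₂ = c := by
  induction h with
  | nil => exact .inl (dist_self x).le
  | @walk y c z h ih =>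
    rcases ih with ih | ⟨γ, c₁, c₂, h₁, h₂, rfl⟩
    · left
      linarith [dist_triangle x y z]
    · exact .inr ⟨γ, c₁, c₂ + dist y z, h₁, h₂.walk z, (add_assoc _ _ _).symm⟩
  | jump γ h _ => exact .inr ⟨γ, _, 0, h, Route.nil, add_zero _⟩

theorem exists_route_lt (x y : S) {ε : ℝ} (hε : 0 < ε) :
    ∃ c, Route Γ x₀ y₀ Δ x y c ∧ c < routeDist Γ x₀ y₀ Δ x y + ε :=
  exists_lt_of_csInf_lt ⟨_, Route.of_dist x y⟩ (lt_add_of_pos_right _ hε)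

variable [IsIsometricSMul Γ S]

theorem Route.smul (h : Route Γ x₀ y₀ Δ x y c) (g : Γ) :
    Route Γ x₀ y₀ Δ (g • x) (g • y) c := by
  induction h with
  | nil => exact Route.nil
  | walk z _ ih =>
    rw [← dist_smul g]
    exact ih.walk (g • z)
  | jump γ _ ih =>
    rw [← mul_smul] at ih ⊢
    exact ih.jump (g * γ)

theorem routeDist_smul (g : Γ) (x y : S) :
    routeDist Γ x₀ y₀ Δ (g • x) (g • y) = routeDist Γ x₀ y₀ Δ x y :=
  congrArg sInf <| Set.ext fun _ =>
    ⟨fun h => inv_smul_smul g x ▸ inv_smul_smul g y ▸ Route.smul h g⁻¹, fun h => Route.smul h g⟩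

theorem Route.dist_le_two_mul (hL : 2 * Δ ≤ dist x₀ y₀) (h : Route Γ x₀ y₀ Δ x y c) :
    dist x y ≤ 2 * c := by
  induction h with
  | nil => simp only [dist_self, mul_zero, le_refl]
  | @walk y c z _ ih => linarith [dist_triangle x y z, dist_nonneg (x := y) (y := z)]
  | jump γ _ ih => linarith [dist_triangle x (γ • x₀) (γ • y₀), dist_smul γ x₀ y₀]

theorem routeDist_le (hL : 2 * Δ ≤ dist x₀ y₀) (h : Route Γ x₀ y₀ Δ x y c) :
    routeDist Γ x₀ y₀ Δ x y ≤ c :=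
  csInf_le ⟨0, fun c hc => by
    linarith [Route.dist_le_two_mul hL hc, dist_nonneg (x := x) (y := y)]⟩ h

theorem isDirectedDist_routeDist (hL : 2 * Δ ≤ dist x₀ y₀) :
    IsDirectedDist (routeDist Γ x₀ y₀ Δ) where
  triangle x y z := by
    refine le_of_forall_pos_le_add fun ε hε => ?_
    obtain ⟨c, hc, hcε⟩ := exists_route_lt (Γ := Γ) (x₀ := x₀) (y₀ := y₀) (Δ := Δ) x y (half_pos hε)
    obtain ⟨d, hd, hdε⟩ := exists_route_lt (Γ := Γ) (x₀ := x₀) (y₀ := y₀) (Δ := Δ) y z (half_pos hε)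
    linarith [routeDist_le hL (hc.trans hd)]
  le_dist x y := routeDist_le hL (Route.of_dist x y)
  dist_le x y := by
    rw [← div_le_iff₀' two_pos]
    exact le_csInf ⟨_, Route.of_dist x y⟩ fun c hc =>
      (div_le_iff₀' two_pos).2 (Route.dist_le_two_mul hL hc)

theorem Route.exists_isCostPath (hS : IsGeodesicSpace S) (hΔ : 0 ≤ Δ) (hL : 2 * Δ ≤ dist x₀ y₀)
    (h : Route Γ x₀ y₀ Δ x y c) :
    ∃ f, f 0 = x ∧ f c = y ∧ IsCostPath (routeDist Γ x₀ y₀ Δ) Δ c f := by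
  have hρ : IsDirectedDist (routeDist Γ x₀ y₀ Δ) := isDirectedDist_routeDist hL
  have segment {y z : S} {d : ℝ} (hyz : Route Γ x₀ y₀ Δ y z d) (hd : dist y z ≤ d + Δ) :=
    hρ.exists_isCostPath hS hΔ (hyz.dist_le_two_mul hL) hd (routeDist_le hL hyz)
  have append {y z : S} {c d : ℝ} (hyz : Route Γ x₀ y₀ Δ y z d) (hd : dist y z ≤ d + Δ) :
      (∃ f, f 0 = x ∧ f c = y ∧ IsCostPath (routeDist Γ x₀ y₀ Δ) Δ c f) →
      ∃ f, f 0 = x ∧ f (c + d) = z ∧ IsCostPath (routeDist Γ x₀ y₀ Δ) Δ (c + d) f := by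
    rintro ⟨f, hfx, hfy, hf⟩
    obtain ⟨g, hgy, hgz, hg⟩ := segment hyz hd
    have hfg : f c = g 0 := hfy.trans hgy.symm
    exact ⟨concat c f g, (concat_of_le f g hf.nonneg).trans hfx,
      (concat_add hfg hg.nonneg).trans hgz, hf.concat hρ hg hfg⟩
  induction h with
  | nil => exact segment Route.nil (by rwa [dist_self, zero_add])
  | @walk y c z _ ih => exact append (Route.of_dist y z) (le_add_of_nonneg_right hΔ) ih
  | jump γ _ ih => exact append (Route.of_jump γ) (by rw [dist_smul, sub_add_cancel]) ih

theorem isCoarselyGeodesic_routeDist (hS : IsGeodesicSpace S) (hΔ : 0 ≤ Δ)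
    (hL : 2 * Δ ≤ dist x₀ y₀) : IsCoarselyGeodesic (routeDist Γ x₀ y₀ Δ) Δ := by
  intro x y
  obtain ⟨c, hc, hlt⟩ := exists_route_lt (Γ := Γ) (x₀ := x₀) (y₀ := y₀) (Δ := Δ) x y one_pos
  obtain ⟨f, hf⟩ := hc.exists_isCostPath hS hΔ hL
  exact ⟨c, f, hlt.le, hf⟩

theorem dist_le_routeDist_add_or_exists_detour {κ C ε : ℝ} (h : FourPointCondition S κ)
    (hS : IsGeodesicSpace S) (hL : 2 * Δ ≤ dist x₀ y₀)
    (hC : AlmostAdditive κ C (routeDist Γ x₀ y₀ Δ)) (hε : 0 < ε) (x y : S) :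
    dist x y ≤ routeDist Γ x₀ y₀ Δ x y + ε ∨
      ∃ γ : Γ, dist x (γ • x₀) + dist x₀ y₀ + dist (γ • y₀) y ≤
        dist x y + 2 * (κ + 2 * (2 * C + ε)) := by
  have hρ : IsDirectedDist (routeDist Γ x₀ y₀ Δ) := isDirectedDist_routeDist hL
  obtain ⟨c, hc, hcε⟩ := exists_route_lt (Γ := Γ) (x₀ := x₀) (y₀ := y₀) (Δ := Δ) x y hε
  rcases hc.dist_le_or_exists_jump with hle | ⟨γ, c₁, c₂, h₁, h₂, rfl⟩
  · exact .inl (hle.trans hcε.le)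
  right
  have hc₁ := routeDist_le hL h₁
  have hc₂ := routeDist_le hL h₂
  have hjump := routeDist_le hL (Route.of_jump (x₀ := x₀) (y₀ := y₀) (Δ := Δ) γ)
  have hstart : excess x y (γ • x₀) ≤ κ + 2 * (2 * C + ε) := hC.excess_le h hS hρ <| by
    linarith [hρ.triangle (γ • x₀) (γ • y₀) y]
  have hend : excess (γ • x₀) y (γ • y₀) ≤ κ + 2 * (2 * C + ε) := hC.excess_le h hS hρ <| by
    linarith [hρ.triangle x (γ • x₀) y]
  refine ⟨γ, ?_⟩
  unfold excess at hstart hend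
  rw [dist_smul] at hend
  linarith

end Routes

/-! ### Quasimorphisms and stable commutator length -/

section Quasimorphism

open scoped commutatorElement

variable {Γ : Type*} [Group Γ] {φ : Γ → ℝ} {D : ℝ}

theorem IsQuasimorphism.abs_map_one_le (hφ : IsQuasimorphism φ D) : |φ 1| ≤ D := by
  simpa only [mul_one, sub_self, zero_sub, abs_neg] using hφ 1 1

theorem IsQuasimorphism.abs_map_commutator_le (hφ : IsQuasimorphism φ D) (a b : Γ) :
    |φ ⁅a, b⁆| ≤ 7 * D := by
  have hone := abs_le.1 hφ.abs_map_one_le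
  have ha := abs_le.1 (hφ a a⁻¹)
  have hb := abs_le.1 (hφ b b⁻¹)
  have hab := abs_le.1 (hφ a b)
  have haba := abs_le.1 (hφ (a * b) a⁻¹)
  have habab := abs_le.1 (hφ (a * b * a⁻¹) b⁻¹)
  rw [mul_inv_cancel] at ha hb
  rw [commutatorElement_def, abs_le]
  constructor <;> linarith

theorem IsQuasimorphism.abs_map_prod_le (hφ : IsQuasimorphism φ D) (l : List Γ)
    (hl : ∀ a ∈ l, a ∈ commutatorSet Γ) : |φ l.prod| ≤ 8 * D * l.length + D := by
  induction l with
  | nil =>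
    rw [List.prod_nil, List.length_nil, Nat.cast_zero, mul_zero, zero_add]
    exact hφ.abs_map_one_le
  | cons a l ih =>
    rw [List.forall_mem_cons] at hl
    obtain ⟨⟨x, y, rfl⟩, hl⟩ := hl
    have htail := abs_le.1 (ih hl)
    have hhead := abs_le.1 (hφ.abs_map_commutator_le x y)
    have hmul := abs_le.1 (hφ ⁅x, y⁆ l.prod)
    rw [List.prod_cons, List.length_cons, abs_le]
    push_cast
    constructor <;> linarith

theorem inv_mem_commutatorSet (a : Γ) (ha : a ∈ commutatorSet Γ) : a⁻¹ ∈ commutatorSet Γ := by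
  obtain ⟨x, y, rfl⟩ := ha
  exact ⟨y, x, (commutatorElement_inv x y).symm⟩

theorem IsQuasimorphism.abs_map_le (hφ : IsQuasimorphism φ D) {g : Γ}
    (hg : g ∈ Subgroup.closure (commutatorSet Γ)) :
    |φ g| ≤ 8 * D * wordNorm (commutatorSet Γ) g + D := by
  obtain ⟨l, hl, hlA, rfl⟩ := exists_word inv_mem_commutatorSet hg
  rw [← hl]
  exact hφ.abs_map_prod_le l hlA

theorem extStableWordNorm_pow {A : Set Γ} (hA : ∀ a ∈ A, a⁻¹ ∈ A) (g : Γ) {N : ℕ} (hN : 0 < N) :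
    extStableWordNorm A (g ^ N) = N * extStableWordNorm A g := by
  by_cases hex : ∃ m : ℕ, 0 < m ∧ g ^ m ∈ Subgroup.closure A
  · obtain ⟨m, hm, hgm⟩ := hex
    have hgNm : (g ^ N) ^ m ∈ Subgroup.closure A := by
      rw [← pow_mul, mul_comm, pow_mul]
      exact pow_mem hgm N
    rw [extStableWordNorm_eq hA hm hgNm, extStableWordNorm_eq hA hm hgm, ← pow_mul, mul_comm N m,
      pow_mul, stableWordNorm_pow hA hgm hN, mul_div_assoc, ENNReal.ofReal_mul N.cast_nonneg,
      ENNReal.ofReal_natCast]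
  · have hex' : ¬∃ m : ℕ, 0 < m ∧ (g ^ N) ^ m ∈ Subgroup.closure A := by
      rintro ⟨m, hm, hgm⟩
      rw [← pow_mul] at hgm
      exact hex ⟨N * m, by positivity, hgm⟩
    rw [extStableWordNorm, extStableWordNorm, dif_neg hex, dif_neg hex',
      ENNReal.mul_top (by exact_mod_cast hN.ne')]

theorem ofReal_le_extStableWordNorm {A : Set Γ} (hA : ∀ a ∈ A, a⁻¹ ∈ A) {g : Γ} {r F : ℝ}
    (h : ∀ n : ℕ, 0 < n → g ^ n ∈ Subgroup.closure A → n * r ≤ wordNorm A (g ^ n) + F) :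
    ENNReal.ofReal r ≤ extStableWordNorm A g := by
  by_cases hex : ∃ m : ℕ, 0 < m ∧ g ^ m ∈ Subgroup.closure A
  swap
  · rw [extStableWordNorm, dif_neg hex]
    exact le_top
  obtain ⟨m, hm, hgm⟩ := hex
  rw [extStableWordNorm_eq hA hm hgm]
  refine ENNReal.ofReal_le_ofReal ((le_div_iff₀ (by exact_mod_cast hm)).2 ?_)
  have hlim := (tendsto_stableWordNorm hA hgm).add (tendsto_const_div_atTop_nhds_zero_nat F)
  rw [add_zero] at hlim
  refine ge_of_tendsto hlim ?_
  filter_upwards [eventually_gt_atTop 0] with n hn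
  have hmn := h (m * n) (by positivity) (by rw [pow_mul]; exact pow_mem hgm n)
  rw [← add_div, le_div_iff₀ (by exact_mod_cast hn), ← pow_mul]
  push_cast at hmn
  linarith

theorem ofReal_le_scl (hD : 0 < D) {g : Γ} {N : ℕ} (hN : 0 < N) {B F : ℝ}
    (h : ∀ n : ℕ, 0 < n → ∃ φ : Γ → ℝ, IsQuasimorphism φ D ∧ n * B ≤ |φ ((g ^ N) ^ n)| + F) :
    ENNReal.ofReal (B / (8 * D * N)) ≤ scl g := by
  have hN' : (0 : ℝ) < N := by exact_mod_cast hN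
  have hpow : ENNReal.ofReal (B / (8 * D)) ≤ N * scl g := by
    rw [scl, ← extStableWordNorm_pow inv_mem_commutatorSet g hN]
    refine ofReal_le_extStableWordNorm inv_mem_commutatorSet (F := (D + F) / (8 * D))
      fun n hn hgn => ?_
    obtain ⟨φ, hφ, hB⟩ := h n hn
    have := hφ.abs_map_le hgn
    rw [← mul_div_assoc, ← sub_le_iff_le_add, ← sub_div, div_le_iff₀ (by positivity)]
    linarith
  rw [← div_div, ENNReal.ofReal_div_of_pos hN', ENNReal.ofReal_natCast]
  exact ENNReal.div_le_of_le_mul' hpow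

theorem pow_mem_commutatorSet_of_conj_eq_inv {a h : Γ} (hconj : h * a * h⁻¹ = a⁻¹) (k : ℕ) :
    (a ^ 2) ^ k ∈ commutatorSet Γ := by
  refine ⟨a ^ k, h, ?_⟩
  have hk : h * (a ^ k)⁻¹ * h⁻¹ = a ^ k := by
    rw [← conj_inv, ← conj_pow, hconj, inv_pow, inv_inv]
  rw [commutatorElement_def, mul_assoc, mul_assoc, ← mul_assoc h, hk, ← pow_add, ← pow_mul,
    two_mul]

theorem extStableWordNorm_eq_zero {A : Set Γ} (hA : ∀ a ∈ A, a⁻¹ ∈ A) {g : Γ} {m : ℕ}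
    (hm : 0 < m) (h : ∀ n, (g ^ m) ^ n ∈ A) : extStableWordNorm A g = 0 := by
  have hmem : g ^ m ∈ Subgroup.closure A :=
    Subgroup.subset_closure (by simpa only [pow_one] using h 1)
  have hzero : stableWordNorm A (g ^ m) = 0 := by
    refine tendsto_nhds_unique (tendsto_stableWordNorm hA hmem) <|
      squeeze_zero (fun n => by positivity) (fun n => ?_)
        (tendsto_const_div_atTop_nhds_zero_nat 1)
    have hone : wordNorm A ((g ^ m) ^ n) ≤ 1 :=
      Nat.sInf_le ⟨[(g ^ m) ^ n], rfl, List.forall_mem_singleton.2 (h n), List.prod_singleton⟩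
    gcongr
    exact_mod_cast hone
  rw [extStableWordNorm_eq hA hm hmem, hzero, zero_div, ENNReal.ofReal_zero]

theorem scl_eq_zero_of_isAchiral {g : Γ} (hg : IsAchiral g) : scl g = 0 := by
  obtain ⟨m, hm, hconj⟩ := hg
  obtain ⟨h, hh⟩ := isConj_iff.1 hconj
  rw [zpow_neg, zpow_natCast] at hh
  refine extStableWordNorm_eq_zero inv_mem_commutatorSet (m := m * 2) (by omega) fun n => ?_
  rw [pow_mul]
  exact pow_mem_commutatorSet_of_conj_eq_inv hh n

end Quasimorphism

/-! ### Reversed pieces of an axis -/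

section Reversed

variable {Γ S : Type*} [Group Γ] [MetricSpace S] [MulAction Γ S] [IsIsometricSMul Γ S]
  {κ τ B M : ℝ} {g γ : Γ} {x₀ : S} {N K : ℕ}

theorem IsQuasiAxis.dist_pow_smul_le (hg : IsQuasiAxis g x₀ τ B K) {i j : ℕ} (hij : i ≤ j)
    (hj : j ≤ K) : dist (g ^ i • x₀) (g ^ j • x₀) ≤ (j - i) * τ + B := by
  rw [dist_pow_smul g x₀ hij, ← Nat.cast_sub hij]
  exact hg.dist_le _ ((Nat.sub_le j i).trans hj)

theorem IsQuasiAxis.isNearPosition (hg : IsQuasiAxis g x₀ τ B K) {i : ℕ} (hi : i ≤ K) :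
    IsNearPosition (g ^ K • x₀) x₀ (i * τ) B (g ^ (K - i) • x₀) := by
  have hlength := hg.mul_le_dist K le_rfl
  have hleft := hg.dist_pow_smul_le (K.sub_le i) le_rfl
  have hright := hg.dist_le (K - i) (K.sub_le i)
  rw [Nat.cast_sub hi] at hleft hright
  rw [IsNearPosition, dist_comm _ x₀, dist_comm _ x₀, dist_comm (g ^ K • x₀)]
  constructor <;> linarith

/-- Up to the error `M`, the translate by `γ` of the piece of the axis of `g` from `x₀` to
`g ^ N • x₀` lies on the piece from `x₀` to `g ^ K • x₀`, but runs in the opposite direction. -/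
def IsReversed (g γ : Γ) (x₀ : S) (N K : ℕ) (M : ℝ) : Prop :=
  dist (g ^ K • x₀) (γ • x₀) + dist x₀ (g ^ N • x₀) + dist (γ • g ^ N • x₀) x₀ ≤
    dist (g ^ K • x₀) x₀ + M

theorem IsReversed.isNearPosition (hγ : IsReversed g γ x₀ N K M) (hg : IsQuasiAxis g x₀ τ B K)
    (hNK : N ≤ K) {k : ℕ} (hk : k ≤ N) :
    IsNearPosition (g ^ K • x₀) x₀ (dist (g ^ K • x₀) (γ • x₀) + k * τ) (B + M)
      (γ • g ^ k • x₀) := by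
  have hM : 0 ≤ M := by
    have := dist_triangle4 (g ^ K • x₀) (γ • x₀) (γ • g ^ N • x₀) x₀
    rw [dist_smul] at this
    unfold IsReversed at hγ
    linarith
  have hlength := hg.mul_le_dist N hNK
  have hleft := hg.dist_le k (hk.trans hNK)
  have hright := hg.dist_pow_smul_le hk hNK
  have hto := dist_triangle (g ^ K • x₀) (γ • x₀) (γ • g ^ k • x₀)
  have hfrom := dist_triangle (γ • g ^ k • x₀) (γ • g ^ N • x₀) x₀
  rw [dist_smul] at hto hfrom
  unfold IsReversed at hγ
  constructor <;> linarith

theorem IsReversed.isNearPosition_pow_smul (hγ : IsReversed g γ x₀ N K M)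
    (h : FourPointCondition S κ) (hg : IsQuasiAxis g x₀ τ B K) (hτ : 0 ≤ τ) (hNK : N ≤ K)
    {i j : ℕ} (hij : i ≤ j) (hj : j ≤ N) :
    IsNearPosition (g ^ K • x₀) x₀ (dist (g ^ K • x₀) (γ • x₀) + (j - i) * τ) (2 * B + M + κ)
      (g ^ i • γ • g ^ j • x₀) := by
  have hiK : i ≤ K := by omega
  have hZ := hγ.isNearPosition hg hNK hj
  have hdist := h.dist_le_of_isNearPosition (hg.isNearPosition hiK) hZ
  have hshift : 0 ≤ dist (g ^ K • x₀) (γ • x₀) + (j - i) * τ :=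
    add_nonneg dist_nonneg (mul_nonneg (sub_nonneg.2 (by exact_mod_cast hij)) hτ)
  rw [abs_sub_comm, abs_of_nonneg (by linarith)] at hdist
  have hK : g ^ K • x₀ = g ^ i • g ^ (K - i) • x₀ := by
    rw [← mul_smul, ← pow_add, Nat.add_sub_cancel' hiK]
  have hback := dist_triangle (g ^ i • γ • g ^ j • x₀) (g ^ i • x₀) x₀
  rw [dist_smul, dist_comm (g ^ i • x₀)] at hback
  refine ⟨?_, ?_⟩
  · nth_rw 1 [hK]
    rw [dist_smul]
    linarith
  · linarith [hZ.2, hg.dist_le i hiK, h.nonneg x₀]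

/-- Both `g ^ i` and its conjugate by `γ` translate by `i * τ` along the reversed piece, but in
opposite directions. -/
theorem IsReversed.dist_smul_le (hγ : IsReversed g γ x₀ N K M) (h : FourPointCondition S κ)
    (hg : IsQuasiAxis g x₀ τ B K) (hτ : 0 ≤ τ) (hNK : N ≤ K) {i j : ℕ} (hij : i ≤ j)
    (hj : j ≤ N) :
    dist (γ • g ^ j • x₀) ((γ * g ^ i * γ⁻¹ * g ^ i) • γ • g ^ j • x₀) ≤
      3 * B + 2 * M + 2 * κ := by
  have hpos := hγ.isNearPosition hg hNK ((Nat.sub_le j i).trans hj)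
  rw [Nat.cast_sub hij] at hpos
  have hdist := h.dist_le_of_isNearPosition hpos
    (hγ.isNearPosition_pow_smul h hg hτ hNK hij hj)
  rw [sub_self, abs_zero] at hdist
  have hZ : γ • g ^ j • x₀ = (γ * g ^ i * γ⁻¹) • γ • g ^ (j - i) • x₀ := by
    rw [mul_smul, inv_smul_smul, mul_smul, ← mul_smul (g ^ i), ← pow_add,
      Nat.add_sub_cancel' hij]
  rw [mul_smul (γ * g ^ i * γ⁻¹)]
  nth_rw 1 [hZ]
  rw [_root_.dist_smul]
  linarith

theorem isAchiral_of_conj_mul_eq {i j : ℕ} (hij : i < j)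
    (he : γ * g ^ i * γ⁻¹ * g ^ i = γ * g ^ j * γ⁻¹ * g ^ j) : IsAchiral g := by
  obtain ⟨k, rfl⟩ := Nat.exists_eq_add_of_lt hij
  refine ⟨k + 1, k.succ_pos, isConj_iff.2 ⟨γ, ?_⟩⟩
  rw [zpow_neg, zpow_natCast, eq_inv_iff_mul_eq_one]
  rw [add_assoc, pow_add] at he
  have hcomm : g ^ i * g ^ (k + 1) = g ^ (k + 1) * g ^ i := pow_mul_comm g i (k + 1)
  have hfactor : γ * (g ^ i * g ^ (k + 1)) * γ⁻¹ * (g ^ i * g ^ (k + 1)) =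
      γ * g ^ i * γ⁻¹ * ((γ * g ^ (k + 1) * γ⁻¹ * g ^ (k + 1)) * g ^ i) := by
    nth_rw 2 [hcomm]
    group
  rw [hfactor] at he
  exact mul_eq_right.1 (mul_left_cancel he).symm

theorem IsAcylindrical.exists_isAchiral_of_isReversed (hΓ : IsAcylindrical Γ S)
    (h : FourPointCondition S κ) (hκ : 0 < κ) {τ₀ : ℝ} (hτ₀ : 0 < τ₀) (hB : 0 ≤ B)
    (hM : 0 ≤ M) : ∃ N₀, ∀ N ≥ N₀, ∀ (g γ : Γ) (x₀ : S) (τ : ℝ) (K : ℕ), τ₀ ≤ τ → N ≤ K →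
      IsQuasiAxis g x₀ τ B K → IsReversed g γ x₀ N K M → IsAchiral g := by
  obtain ⟨R, N₁, -, -, hRN⟩ := hΓ (3 * B + 2 * M + 2 * κ) (by positivity)
  obtain ⟨N₂, hN₂⟩ := exists_nat_ge (R / τ₀)
  rw [div_le_iff₀ hτ₀] at hN₂
  refine ⟨N₁ + N₂, fun N hN g γ x₀ τ K hτ hNK hg hγ => ?_⟩
  have hτ0 : 0 ≤ τ := hτ₀.le.trans hτ
  have hN₁ : N₁ ≤ N := by omega
  have hfar : R ≤ dist (γ • g ^ N₁ • x₀) (γ • g ^ N • x₀) := by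
    rw [_root_.dist_smul, dist_pow_smul g x₀ hN₁]
    calc R ≤ N₂ * τ₀ := hN₂
      _ ≤ (N - N₁ : ℕ) * τ := by gcongr; omega
      _ ≤ _ := hg.mul_le_dist _ (by omega)
  obtain ⟨i, j, hij, -, he⟩ := exists_lt_map_eq_of_encard_le (hRN _ _ hfar)
    (u := fun i => γ * g ^ i * γ⁻¹ * g ^ i) fun i hi =>
      ⟨hγ.dist_smul_le h hg hτ0 hNK hi hN₁, hγ.dist_smul_le h hg hτ0 hNK (hi.trans hN₁) le_rfl⟩
  exact isAchiral_of_conj_mul_eq hij he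

end Reversed

/-! ### The gap -/

section Gap

variable {Γ S : Type*} [Group Γ] [MetricSpace S] [MulAction Γ S] [IsIsometricSMul Γ S]
  {κ τ B C Δ : ℝ} {x₀ : S}

theorem routeDist_pow_smul_le {a : Γ} (hL : 2 * Δ ≤ dist x₀ (a • x₀)) (n : ℕ) :
    routeDist Γ x₀ (a • x₀) Δ x₀ (a ^ n • x₀) ≤ n * (dist x₀ (a • x₀) - Δ) := by
  refine routeDist_le hL ?_
  induction n with
  | zero =>
    rw [pow_zero, one_smul, Nat.cast_zero, zero_mul]
    exact Route.nil
  | succ n ih =>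
    rw [pow_succ, mul_smul, Nat.cast_succ, add_one_mul]
    exact ih.jump (a ^ n)

theorem routeDist_sub_routeDist_le {g : Γ} {N n : ℕ} (h : FourPointCondition S κ)
    (hS : IsGeodesicSpace S) (hL : 2 * Δ ≤ dist x₀ (g ^ N • x₀))
    (hC : AlmostAdditive κ C (routeDist Γ x₀ (g ^ N • x₀) Δ))
    (hg : IsQuasiAxis g x₀ τ B (N * n)) (hN : N ≤ N * n)
    (hrev : ∀ γ, ¬IsReversed g γ x₀ N (N * n) (2 * (κ + 2 * (2 * C + 1)))) :
    routeDist Γ x₀ (g ^ N • x₀) Δ x₀ ((g ^ N) ^ n • x₀) -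
      routeDist Γ x₀ (g ^ N • x₀) Δ ((g ^ N) ^ n • x₀) x₀ ≤ n * (B - Δ) + 1 := by
  have hforward := routeDist_pow_smul_le hL n
  have hbackward := (dist_le_routeDist_add_or_exists_detour h hS hL hC one_pos
    ((g ^ N) ^ n • x₀) x₀).resolve_right fun ⟨γ, hγ⟩ => hrev γ (by rwa [← pow_mul] at hγ)
  have hlow := hg.mul_le_dist _ le_rfl
  rw [dist_comm, pow_mul, Nat.cast_mul] at hlow
  have hup := mul_le_mul_of_nonneg_left (hg.dist_le N hN) n.cast_nonneg (α := ℝ)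
  linarith

theorem IsAcylindrical.exists_isQuasimorphism_of_isChiral (hΓ : IsAcylindrical Γ S)
    (h : FourPointCondition S κ) (hκ : 0 < κ) (hS : IsGeodesicSpace S) :
    ∃ (D : ℝ) (N : ℕ), 0 < D ∧ 0 < N ∧ ∀ g : Γ, IsLoxodromic S g → IsChiral g → ∀ n : ℕ, 0 < n →
      ∃ φ : Γ → ℝ, IsQuasimorphism φ D ∧ n * (7 * κ) ≤ |φ ((g ^ N) ^ n)| + 1 := by
  obtain ⟨τ₀, hτ₀, hgap⟩ := hΓ.exists_translationLength_ge h hκ hS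
  -- The discount `14 * κ` exceeds the error `7 * κ` of the quasi-axes by `7 * κ` per jump.
  obtain ⟨C₀, hC₀⟩ := h.exists_almostAdditive hS (14 * κ)
  set C := max C₀ 1
  have : 0 < C := one_pos.trans_le (le_max_right _ _)
  obtain ⟨N₁, hN₁⟩ := hΓ.exists_isAchiral_of_isReversed h hκ hτ₀ (B := 7 * κ)
    (M := 2 * (κ + 2 * (2 * C + 1))) (by positivity) (by positivity)
  obtain ⟨N₂, hN₂⟩ := exists_nat_ge (28 * κ / τ₀)
  rw [div_le_iff₀ hτ₀] at hN₂
  refine ⟨3 * C, N₁ + N₂ + 1, by positivity, by omega, fun g hg hchiral n hn => ?_⟩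
  set N := N₁ + N₂ + 1
  obtain ⟨x, -⟩ := id hg
  have hτ := hgap g hg x
  have hNK : N ≤ N * n := Nat.le_mul_of_pos_right N hn
  have hlong {k : ℕ} (hk : N ≤ k) : 28 * κ ≤ k * translationLength g x :=
    hN₂.trans (by gcongr; omega)
  obtain ⟨x₀, hx₀⟩ := h.exists_isQuasiAxis hκ hS g x (K := N * n) (by linarith [hlong hNK])
  have hL : 2 * (14 * κ) ≤ dist x₀ (g ^ N • x₀) := by
    linarith [hlong le_rfl, hx₀.mul_le_dist N hNK]
  have hρ : IsDirectedDist (routeDist Γ x₀ (g ^ N • x₀) (14 * κ)) := isDirectedDist_routeDist hL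
  have hC : AlmostAdditive κ C (routeDist Γ x₀ (g ^ N • x₀) (14 * κ)) := fun y z p hp =>
    (hC₀ _ hρ (isCoarselyGeodesic_routeDist hS (by positivity) hL) y z p hp).trans
      (add_le_add_right (le_max_left _ _) _)
  have hdrop := routeDist_sub_routeDist_le h hS hL hC hx₀ hNK fun γ hγ =>
    hchiral (hN₁ N (by omega) g γ x₀ _ _ hτ hNK hx₀ hγ)
  exact ⟨_, hC.isQuasimorphism h hS hρ routeDist_smul x₀, by
    linarith [neg_le_abs (routeDist Γ x₀ (g ^ N • x₀) (14 * κ) x₀ ((g ^ N) ^ n • x₀) -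
      routeDist Γ x₀ (g ^ N • x₀) (14 * κ) ((g ^ N) ^ n • x₀) x₀)]⟩

theorem exists_scl_gap {δ : ℝ} (hδ : 0 < δ) (hS : IsHyperbolicSpace S δ)
    (hΓ : IsAcylindrical Γ S) :
    ∃ Θ : ℝ, 0 < Θ ∧ ∀ g : Γ, IsLoxodromic S g → IsChiral g → ENNReal.ofReal Θ ≤ scl g := by
  obtain ⟨D, N, hD, hN, hφ⟩ := hΓ.exists_isQuasimorphism_of_isChiral (hS.fourPointCondition hδ)
    (by positivity) hS.isGeodesicSpace
  exact ⟨7 * (10 * δ) / (8 * D * N), by positivity, fun g hg hchiral =>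
    ofReal_le_scl hD hN (hφ g hg hchiral)⟩

end Gap

end SclGap

theorem mainTheorem6 {Γ S : Type*} [Group Γ] [MetricSpace S] [MulAction Γ S]
    [IsIsometricSMul Γ S] (δ : ℝ) (hδ : 0 < δ) (hS : SclGap.IsHyperbolicSpace S δ)
    (hΓ : SclGap.IsAcylindrical Γ S) :
    (∀ g : Γ, SclGap.IsLoxodromic S g → (SclGap.IsAchiral g ↔ SclGap.scl g = 0)) ∧
    ∃ Θ : ℝ, 0 < Θ ∧
      ∀ g : Γ, SclGap.IsLoxodromic S g → SclGap.IsChiral g →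
        ENNReal.ofReal Θ ≤ SclGap.scl g := by
  obtain ⟨Θ, hΘ, hgap⟩ := SclGap.exists_scl_gap hδ hS hΓ
  refine ⟨fun g hg => ⟨SclGap.scl_eq_zero_of_isAchiral, fun hzero => ?_⟩, Θ, hΘ, hgap⟩
  by_contra hch
  have h := hgap g hg hch
  rw [hzero, nonpos_iff_eq_zero, ENNReal.ofReal_eq_zero] at h
  linarith
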